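/- Let $\mathbb R^\infty=\bigcup_{k\ge1}\mathbb R^k$, $\mathbb Z^\infty=\bigcup_k\mathbb Z^k$, $\mathbb Q^\infty=\bigcup_k\mathbb Q^k$, and let $Q$ be an inner product on $\mathbb R^\infty$ with $Q(\mathbb Z^\infty\times\mathbb Z^\infty)\subset\mathbb Q$. A *lattice cone* $(C,\Lambda_C)$ consists of a closed cone $C\subset\mathbb R^\infty$ generated by finitely many vectors of $\mathbb Q^\infty$ and a lattice $\Lambda_C\subset\mathbb Q^\infty$ (of full rank) in the linear span of $C$. Write $C^o$ for the relative interior of $C$ and $(C,\Lambda_C)\perp^Q(D,\Lambda_D)$ if $Q(u,v)=0$ for all $u\in\Lambda_C$, $v\in\Lambda_D$. Let $\mathcal M_{\mathbb Q}=\bigcup_k\mathcal M_{\mathbb Q}((\mathbb R^k)^*\otimes\mathbb C)$ be the space of meromorphic germs at $0$ with linear poles and rational coefficients, i.e. germs $h/(M_1\cdots M_r)$ with $h$ a holomorphic germ at $0$ with rational Taylor coefficients and $M_1,\dots,M_r$ nonzero linear forms with rational coefficients. Vectors of $\mathbb Q^\infty$ are regarded as linear forms on the dual. Two germs $f,f'\in\mathcal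 M_{\mathbb Q}$ are *$Q$-orthogonal*, $f\perp^Q f'$, if $f=g(L_1,\dots,L_m)$ and $f'=g'(L_1',\dots,L_n')$ for some linear forms $L_i,L_j'\in\mathbb Q^\infty$ with $Q(L_i,L_j')=0$ for all $i,j$ and some meromorphic germs $g,g'$ at $0$ in $m$, resp. $n$, variables with linear poles and rational coefficients, for which these substitutions are well defined. For a strongly convex lattice cone (one whose cone contains no line), let $S(C,\Lambda_C)$ and $I(C,\Lambda_C)$ be the germs in $\mathcal M_{\mathbb Q}$ that are given, for real $z$ near $0$ off finitely many rational hyperplanes and with $\langle x,z\rangle<0$ for all $x\in C\setminus\{0\}$, by the convergent expressions $$S(C,\Lambda_C)(z)=\sum_{n\in C^o\cap\Lambda_C}e^{\langle n,z\rangle},\qquad I(C,\Lambda_C)(z)=\int_C e^{\langle x,z\rangle}\,d\Lambda_x,$$ where $d\Lambda_x$ is the Lebesgue measure on the span of $C$ for which the parallelepiped spanned by a basis of $\Lambda_C$ has volume $1$. A *subdivision* of a lattice cone $(C,\Lambda_C)$ is a finite family of strongly convex lattice cones $(D,\Lambda_D)$ whose relative interiors form a partition of $C^o$, with $\Lambda_D=\Lambda_C\cap\operatorname{span}D$.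 **Proposition.** Setting $S(C,\Lambda_C)=\sum_D S(D,\Lambda_D)$, the sum over all members of a subdivision, and $I(C,\Lambda_C)=\sum_{D:\ \Lambda_D=\Lambda_C} I(D,\Lambda_D)$, the sum over its members of full dimension, gives well-defined maps $S$ and $I$ from the set of all lattice cones to $\mathcal M_{\mathbb Q}$: every lattice cone has a subdivision, and the results do not depend on its choice. They are locality maps: if $(C,\Lambda_C)\perp^Q(D,\Lambda_D)$, then $S(C,\Lambda_C)\perp^Q S(D,\Lambda_D)$ and $I(C,\Lambda_C)\perp^Q I(D,\Lambda_D)$. -/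

import Mathlib

open Filter Topology

noncomputable section

namespace ConeLocality

/-- `ℝ^∞ = ⋃ₖ ℝ^k`: real sequences of finite support (`ℝ^k` is spanned by the first `k` unit vectors). -/
abbrev RInf : Type := ℕ →₀ ℝ

/-- The space `(ℝ^∞)^* ⊗ ℂ`, with the product topology. A function on `(ℝ^k)^* ⊗ ℂ` is a
function on this space that depends on the first `k` coordinates only. -/
abbrev DualC : Type := ℕ → ℂ

/-- The unit vectors. -/
def unitVec (i : ℕ) : RInf := Finsupp.single i 1

/-- `x` lies in `ℚ^∞`. -/
def IsRat (x : RInf) : Prop := ∀ i, ∃ q : ℚ, x i = (q : ℝ)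

/-- The canonical pairing `⟨x, z⟩`. Through it a vector `x` is a linear form on the dual. -/
def pair (x : RInf) (z : DualC) : ℂ := x.sum fun i a => (a : ℂ) * z i

/-! ### Lattice cones -/

/-- `b` is a `ℤ`-basis of the lattice `Λ`, and is linearly independent over `ℝ`. -/
def IsLatticeBasis (Λ : Submodule ℤ RInf) {d : ℕ} (b : Fin d → RInf) : Prop :=
  LinearIndependent ℝ b ∧ Submodule.span ℤ (Set.range b) = Λ

/-- A lattice cone: a closed polyhedral cone generated by finitely many rational vectors, with a
lattice of rational vectors in the linear subspace spanned by the cone. -/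
structure LatticeCone where
  cone : Set RInf
  lattice : Submodule ℤ RInf
  polyhedral : ∃ (n : ℕ) (u : Fin n → RInf), (∀ j, IsRat (u j)) ∧
    cone = {x | ∃ c : Fin n → ℝ, (∀ j, 0 ≤ c j) ∧ x = ∑ j, c j • u j}
  lattice_rat : ∀ v ∈ lattice, IsRat v
  isLattice : ∃ (d : ℕ) (b : Fin d → RInf), IsLatticeBasis lattice b ∧
    Submodule.span ℝ (Set.range b) = Submodule.span ℝ cone

namespace LatticeCone

/-- The (relative) interior `C^o` of a convex cone: the points of `C` from which one can move a
little in the direction `-y`, for every `y` in `C`, without leaving `C`. -/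
def interior (C : LatticeCone) : Set RInf :=
  {x | x ∈ C.cone ∧ ∀ y ∈ C.cone, ∃ ε : ℝ, 0 < ε ∧ x - ε • y ∈ C.cone}

/-- The cone contains no line. -/
def StronglyConvex (C : LatticeCone) : Prop := ∀ x ∈ C.cone, -x ∈ C.cone → x = 0

/-- The dual cone `C^-`: the real points `z` of the dual with `⟨x, z⟩ < 0` for all nonzero `x` in `C`. -/
def negDual (C : LatticeCone) : Set DualC :=
  {z | (∀ i, (z i).im = 0) ∧ ∀ x ∈ C.cone, x ≠ 0 → (pair x z).re < 0}

/-- Orthogonality of lattice cones with respect to `Q`. -/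
def Orth (Q : LinearMap.BilinForm ℝ RInf) (C D : LatticeCone) : Prop :=
  ∀ u ∈ C.lattice, ∀ v ∈ D.lattice, Q u v = 0

/-- A subdivision of `C` into strongly convex lattice cones, given by all the cones (of all
dimensions) whose interiors partition the interior of `C`; each piece `D` carries the lattice
induced on its linear span. For a face-to-face subdivision by cones of full dimension,
these are the faces of its members that are not contained in the boundary of `C`. -/
structure IsSubdivision (C : LatticeCone) (P : Finset LatticeCone) : Prop where
  stronglyConvex : ∀ D ∈ P, D.StronglyConvex
  cover : C.interior = ⋃ D ∈ P, D.interior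
  disjoint : (P : Set LatticeCone).PairwiseDisjoint interior
  lattice_eq : ∀ D ∈ P, ∀ v, v ∈ D.lattice ↔ v ∈ C.lattice ∧ v ∈ Submodule.span ℝ D.cone

end LatticeCone

/-! ### Meromorphic germs at `0` with linear poles and rational coefficients -/

/-- Neighbourhoods of `0` in the dual with finitely many rational hyperplanes removed. -/
def poleFilter : Filter DualC :=
  𝓝 0 ⊓ ⨅ (u : RInf) (_ : IsRat u ∧ u ≠ 0), 𝓟 {z | pair u z ≠ 0}

/-- Germs at `0` of complex functions defined off finitely many rational hyperplanes. -/
abbrev PoleGerm : Type := Germ poleFilter ℂ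

/-- `h` is holomorphic at `0` in `ℂ^m`, with rational Taylor coefficients: all its partial
derivatives at `0` are rational. -/
def IsRatHolo {m : ℕ} (h : (Fin m → ℂ) → ℂ) : Prop :=
  AnalyticAt ℂ h 0 ∧ ∀ (n : ℕ) (e : Fin n → Fin m), ∃ q : ℚ,
    iteratedFDeriv ℂ n h 0 (fun j => Pi.single (e j) 1) = (q : ℂ)

/-- `f = g(L₁, …, Lₘ)` for a meromorphic germ `g` at `0` in `ℂ^m` with linear poles and rational
coefficients. Here `g = h / (M₁ ⋯ Mᵣ)` with `h` a holomorphic germ with rational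
coefficients and `Mⱼ` linear forms with rational coefficients (repetitions are allowed), such that
the substitution makes sense: no `Mⱼ(L₁, …, Lₘ)` is the zero form. -/
def IsMeroIn {m : ℕ} (L : Fin m → RInf) (f : PoleGerm) : Prop :=
  ∃ h : (Fin m → ℂ) → ℂ, IsRatHolo h ∧
    ∃ (r : ℕ) (M : Fin r → Fin m → ℚ), (∀ j, ∑ i, (M j i : ℝ) • L i ≠ 0) ∧
      f = ((fun z : DualC => h (fun i => pair (L i) z) /
        ∏ j, ∑ i, (M j i : ℂ) * pair (L i) z : DualC → ℂ) : PoleGerm)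

/-- `𝓜_ℚ = ⋃ₖ 𝓜_ℚ((ℝ^k)^* ⊗ ℂ)`: the germs that are meromorphic with linear poles and rational
coefficients in finitely many of the coordinates. -/
def MQ : Set PoleGerm := {f | ∃ k : ℕ, IsMeroIn (fun i : Fin k => unitVec i) f}

/-- `Q`-orthogonality of germs. -/
def GermOrth (Q : LinearMap.BilinForm ℝ RInf) (f f' : PoleGerm) : Prop :=
  ∃ (m n : ℕ) (L : Fin m → RInf) (L' : Fin n → RInf),
    (∀ i, IsRat (L i)) ∧ (∀ j, IsRat (L' j)) ∧ (∀ i j, Q (L i) (L' j) = 0) ∧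
    IsMeroIn L f ∧ IsMeroIn L' f'

/-! ### Exponential sums and exponential integrals -/

/-- For a strongly convex lattice cone, `f` is the germ in `𝓜_ℚ` given on `C^-` by the
exponential sum over the lattice points in the interior of `C`. -/
def IsConvergentExpSum (C : LatticeCone) (f : PoleGerm) : Prop :=
  f ∈ MQ ∧ ∃ F : DualC → ℂ, f = (F : PoleGerm) ∧
    ∀ᶠ z in poleFilter ⊓ 𝓟 C.negDual,
      HasSum (fun n : {n : RInf // n ∈ C.interior ∧ n ∈ C.lattice} => Complex.exp (pair n.1 z)) (F z)

/-- For a strongly convex lattice cone, `f` is the germ in `𝓜_ℚ` given on `C^-` by the exponential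
integral over `C`, with respect to the Lebesgue measure in the coordinates of a lattice basis. -/
def IsConvergentExpInt (C : LatticeCone) (f : PoleGerm) : Prop :=
  f ∈ MQ ∧ ∃ F : DualC → ℂ, f = (F : PoleGerm) ∧
    ∃ (d : ℕ) (b : Fin d → RInf), IsLatticeBasis C.lattice b ∧
      ∀ᶠ z in poleFilter ⊓ 𝓟 C.negDual,
        MeasureTheory.IntegrableOn (fun t : Fin d → ℝ => Complex.exp (pair (∑ i, t i • b i) z))
          {t | ∑ i, t i • b i ∈ C.cone} ∧
        ∫ t in {t : Fin d → ℝ | ∑ i, t i • b i ∈ C.cone},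
          Complex.exp (pair (∑ i, t i • b i) z) = F z

/-- `f` is the value at `C` of the extension by subdivisions of the exponential sum. -/
def IsExpSum (C : LatticeCone) (f : PoleGerm) : Prop :=
  ∃ (P : Finset LatticeCone) (g : LatticeCone → PoleGerm), C.IsSubdivision P ∧
    (∀ D ∈ P, IsConvergentExpSum D (g D)) ∧ f = ∑ D ∈ P, g D

open Classical in
/-- `f` is the value at `C` of the extension by subdivisions of the exponential integral: only the
pieces of full dimension, that is those with the lattice of `C`, contribute. -/
def IsExpInt (C : LatticeCone) (f : PoleGerm) : Prop :=
  ∃ (P : Finset LatticeCone) (g : LatticeCone → PoleGerm), C.IsSubdivision P ∧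
    (∀ D ∈ P, D.lattice = C.lattice → IsConvergentExpInt D (g D)) ∧
    f = ∑ D ∈ P with D.lattice = C.lattice, g D

/-- A locality map between sets with a binary relation. -/
def IsLocalityMap {X Y : Type*} (r : X → X → Prop) (s : Y → Y → Prop) (φ : X → Y) : Prop :=
  ∀ x y, r x y → s (φ x) (φ y)

end ConeLocality

end

noncomputable section

namespace ConeLocality

/-! ### Decomposition of a finitely generated cone into open simplicial cones -/

section Decomposition

/-! Fix a generic point z of the dual. Summation, or integration in lattice coordinates, against
`e^{⟨x, z⟩}` is an additive functional defined on some functions on `RInf`, and translation of a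
function by u multiplies its value by `e^{⟨u, z⟩}`. Such a functional extends beyond convergence: if
a product of difference operators `1 - τ_u`, all with `e^{⟨u, z⟩} ≠ 1`, carries f into the domain,
the value of f is the value of the result divided by `∏ (1 - e^{⟨u, z⟩})`. Since translations
commute, this extension is additive and single-valued (`RegValue.add`, `RegValue.unique`). It
applies equally to cones that contain lines.

The relative interior of a cone is a finite disjoint union of open simplicial cones
(`exists_simplicial_partition`, `LatticeCone.exists_simplicial_decomposition`). Difference operators
along the generators cut an open simplicial cone down to a half-open parallelepiped
(`diffOps_indicator_openCone`), where the lattice sum is finite and the integral elementary. So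
every lattice cone has a regularized sum and integral, and both are meromorphic in z with linear
poles and rational coefficients. These values depend on the indicator function of the cone alone,
and indicator functions of the members of a subdivision add up to that of the cone. Hence the result
cannot depend on the subdivision, and no common refinements are needed.

For a strongly convex cone a convergent sum or integral is a regularized value, and a germ in `MQ`
is determined by its values on the dual cone near 0 (`eq_of_eventually_negDual`). Thus the
regularized germ is the only candidate for the convergent one. Simplicial cones do converge, so a
simplicial subdivision realizes the value.

Locality: the exponents and poles in the formulas are lattice vectors, so the germ of a lattice cone
is a germ in the vectors of any basis of its lattice. Bases of orthogonal lattices are orthogonal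
(`LatticeCone.Orth.germOrth`). -/

/-- `d` is negative for the lexicographic order given by a list of linear forms. -/
def LexNeg {E : Type*} [AddCommGroup E] [Module ℝ E] : List (E →ₗ[ℝ] ℝ) → E → Prop
  | [], _ => False
  | φ :: l, d => φ d < 0 ∨ (φ d = 0 ∧ LexNeg l d)

theorem LexNeg.smul {E : Type*} [AddCommGroup E] [Module ℝ E] {l : List (E →ₗ[ℝ] ℝ)} {d : E}
    (h : LexNeg l d) {ε : ℝ} (hε : 0 < ε) : LexNeg l (ε • d) := by
  induction l with
  | nil => exact h
  | cons φ l ih =>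
    rcases h with h | ⟨h, h'⟩
    · left
      rw [map_smul, smul_eq_mul]
      exact mul_neg_of_pos_of_neg hε h
    · right
      exact ⟨by rw [map_smul, h, smul_zero], ih h'⟩

theorem lexNeg_trichotomy {E : Type*} [AddCommGroup E] [Module ℝ E] (l : List (E →ₗ[ℝ] ℝ)) (d : E) :
    LexNeg l d ∨ LexNeg l (-d) ∨ ∀ φ ∈ l, φ d = 0 := by
  induction l with
  | nil => simp
  | cons φ l ih =>
    rcases lt_trichotomy (φ d) 0 with h | h | h
    · exact Or.inl (Or.inl h)
    · rcases ih with h' | h' | h'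
      · exact Or.inl (Or.inr ⟨h, h'⟩)
      · exact Or.inr (Or.inl (Or.inr ⟨by simp [h], h'⟩))
      · refine Or.inr (Or.inr ?_)
        simpa [h] using h'
    · exact Or.inr (Or.inl (Or.inl (by simpa using h)))

/-- Minimize the forms in turn, each on the compact set of minimizers left by the previous ones. -/
theorem exists_lexMin {ι : Type*} [Finite ι] (l : List ((ι → ℝ) →ₗ[ℝ] ℝ)) {K : Set (ι → ℝ)}
    (hK : IsCompact K) (hne : K.Nonempty) : ∃ c ∈ K, ∀ c' ∈ K, ¬ LexNeg l (c' - c) := by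
  induction l generalizing K with
  | nil => exact ⟨hne.some, hne.some_mem, fun _ _ h => h⟩
  | cons φ l ih =>
    have hφ : Continuous φ := LinearMap.continuous_on_pi φ
    obtain ⟨c₀, hc₀, hmin⟩ := hK.exists_isMinOn hne hφ.continuousOn
    have hclosed : IsClosed {c | φ c = φ c₀} := isClosed_eq hφ continuous_const
    obtain ⟨c, ⟨hcK, hc⟩, hlex⟩ := ih (hK.inter_right hclosed) ⟨c₀, hc₀, rfl⟩
    have hc : φ c = φ c₀ := hc
    refine ⟨c, hcK, fun c' hc' hneg => ?_⟩
    have hle : φ c₀ ≤ φ c' := hmin hc'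
    rcases hneg with h | ⟨h, h'⟩
    · rw [map_sub] at h
      linarith
    · rw [map_sub] at h
      exact hlex c' ⟨hc', show φ c' = φ c₀ by linarith⟩ h'

theorem exists_pos_forall_add_mul_nonneg {ι : Type*} [Finite ι] (c d : ι → ℝ)
    (h : ∀ j, 0 < c j ∨ (0 ≤ c j ∧ 0 ≤ d j)) : ∃ ε : ℝ, 0 < ε ∧ ∀ j, 0 ≤ c j + ε * d j := by
  have key : ∀ᶠ ε : ℝ in 𝓝[>] 0, ∀ j, 0 ≤ c j + ε * d j := by
    rw [eventually_all]
    intro j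
    rcases h j with h | ⟨h, h'⟩
    · have ht : Tendsto (fun ε : ℝ => c j + ε * d j) (𝓝[>] 0) (𝓝 (c j)) := by
        have : Continuous (fun ε : ℝ => c j + ε * d j) := by fun_prop
        simpa using (this.tendsto 0).mono_left nhdsWithin_le_nhds
      filter_upwards [ht.eventually (lt_mem_nhds h)] with ε hε using hε.le
    · filter_upwards [self_mem_nhdsWithin] with ε hε
      have : (0 : ℝ) < ε := hε
      positivity
  obtain ⟨ε, h1, h2⟩ := (key.and self_mem_nhdsWithin).exists
  exact ⟨ε, h2, h1⟩

variable {V : Type*} [AddCommGroup V] [Module ℝ V]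

/-- The cone of the nonnegative combinations of a family of vectors. -/
def closedCone {ι : Type*} [Fintype ι] (u : ι → V) : Set V :=
  {x | ∃ c : ι → ℝ, (∀ j, 0 ≤ c j) ∧ x = ∑ j, c j • u j}

/-- The set of the positive combinations of a family of vectors. -/
def openCone {ι : Type*} [Fintype ι] (u : ι → V) : Set V :=
  {x | ∃ c : ι → ℝ, (∀ j, 0 < c j) ∧ x = ∑ j, c j • u j}

/-- Each point of the closed cone has a unique lexicographically smallest nonnegative
representation. Sorting the points by the support of this representation gives the partition. -/
theorem exists_simplicial_partition {ι : Type*} [Fintype ι] [DecidableEq ι] (u : ι → V) :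
    ∃ 𝒥 : Set (Finset ι), (∀ J ∈ 𝒥, LinearIndependent ℝ (fun j : J => u j)) ∧
      closedCone u = ⋃ J ∈ 𝒥, openCone (fun j : J => u j) ∧
      𝒥.PairwiseDisjoint (fun J => openCone (fun j : J => u j)) := by
  set s : (ι → ℝ) →ₗ[ℝ] ℝ := ∑ j, LinearMap.proj j with hs
  -- The sum of the coefficients comes first, to make the representations that compete with a given
  -- one a compact set. The coordinates after it make the order total, which is `hzero`.
  set l : List ((ι → ℝ) →ₗ[ℝ] ℝ) :=
    s :: Finset.univ.toList.map (fun j => LinearMap.proj j) with hl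
  have hzero : ∀ d : ι → ℝ, ¬ LexNeg l d → ¬ LexNeg l (-d) → d = 0 := by
    intro d h1 h2
    rcases lexNeg_trichotomy l d with h | h | h
    · exact absurd h h1
    · exact absurd h h2
    · ext j
      exact h (LinearMap.proj j) (by simp [hl])
  have hext : ∀ (J : Finset ι) (c : J → ℝ), ∃ c' : ι → ℝ, (∀ j : J, c' j = c j) ∧
      (∀ j ∉ J, c' j = 0) ∧ ∑ j, c' j • u j = ∑ j : J, c j • u j := by
    intro J c
    refine ⟨fun j => if h : j ∈ J then c ⟨j, h⟩ else 0, fun j => by simp, fun j hj => by simp [hj], ?_⟩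
    rw [← Finset.sum_subset (Finset.subset_univ J) (fun j _ hj => by simp [hj]),
      ← Finset.sum_coe_sort J]
    exact Finset.sum_congr rfl (fun j _ => by simp)
  -- At a representation with support J, the directions that keep the point fixed and the
  -- coefficients nonnegative are the linear relations that are nonnegative off J. So J is good when
  -- representations with support J are lexicographically minimal.
  set Good : Finset ι → Prop := fun J =>
    ∀ d : ι → ℝ, ∑ j, d j • u j = 0 → (∀ j ∉ J, 0 ≤ d j) → ¬ LexNeg l d with hGood
  refine ⟨{J | Good J}, ?_, ?_, ?_⟩
  · intro J hJ
    rw [Fintype.linearIndependent_iff]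
    intro g hg
    obtain ⟨d, hd1, hd2, hd3⟩ := hext J g
    have hd0 : ∑ j, d j • u j = 0 := hd3.trans hg
    have : d = 0 := hzero d (hJ d hd0 (fun j hj => (hd2 j hj).ge))
      (hJ (-d) (by simp [hd0]) (fun j hj => by simp [hd2 j hj]))
    intro j
    rw [← hd1 j, this]
    rfl
  · ext x
    simp only [Set.mem_iUnion]
    constructor
    · rintro ⟨c₀, hc₀, rfl⟩
      set A : (ι → ℝ) →ₗ[ℝ] V := Fintype.linearCombination ℝ u with hA
      have hAapp : ∀ c, A c = ∑ j, c j • u j := fun c => Fintype.linearCombination_apply ℝ u c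
      set K : Set (ι → ℝ) := Set.Icc 0 (fun _ => s c₀) ∩
        ((fun c => c - c₀) ⁻¹' (LinearMap.ker A : Set (ι → ℝ)) ∩ {c | s c ≤ s c₀}) with hK
      have hscont : Continuous s := LinearMap.continuous_on_pi s
      have hKc : IsCompact K := by
        refine isCompact_Icc.inter_right (IsClosed.inter ?_ (isClosed_le hscont continuous_const))
        exact (Submodule.closed_of_finiteDimensional (LinearMap.ker A)).preimage (by fun_prop)
      have hs_apply : ∀ c, s c = ∑ j, c j := fun c => by simp [hs]
      have hle : ∀ c : ι → ℝ, (∀ j, 0 ≤ c j) → ∀ j, c j ≤ s c := by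
        intro c hc j
        rw [hs_apply]
        exact Finset.single_le_sum (fun i _ => hc i) (Finset.mem_univ j)
      have hKmem : ∀ c, (∀ j, 0 ≤ c j) → A c = A c₀ → s c ≤ s c₀ → c ∈ K := by
        intro c h1 h2 h3
        refine ⟨⟨h1, fun j => (hle c h1 j).trans h3⟩, ?_, h3⟩
        simp [h2]
      obtain ⟨c, hcK, hlex⟩ := exists_lexMin l hKc ⟨c₀, hKmem c₀ hc₀ rfl le_rfl⟩
      obtain ⟨⟨hc0, -⟩, hcA, hcs⟩ := hcK
      have hcA : A c = A c₀ := by simpa [sub_eq_zero] using hcA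
      have hcs : s c ≤ s c₀ := hcs
      refine ⟨Finset.univ.filter (fun j => 0 < c j), ?_, fun j => c j, ?_, ?_⟩
      · intro d hd1 hd2 hneg
        have hsd : s d ≤ 0 := by
          rcases hneg with h | ⟨h, -⟩
          exacts [h.le, h.le]
        obtain ⟨ε, hε, hpos⟩ := exists_pos_forall_add_mul_nonneg c d (fun j => by
          by_cases hj : 0 < c j
          · exact Or.inl hj
          · exact Or.inr ⟨hc0 j, hd2 j (by simpa using hj)⟩)
        -- A small step along d would give a lexicographically smaller representation of the same
        -- point.
        refine hlex (c + ε • d) (hKmem _ (fun j => by simpa using hpos j) ?_ ?_) ?_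
        · rw [map_add, map_smul, hAapp d, hd1, smul_zero, add_zero, hcA]
        · rw [map_add, map_smul, smul_eq_mul]
          nlinarith
        · simpa using hneg.smul hε
      · rintro ⟨j, hj⟩
        simpa using hj
      · rw [← hAapp, ← hcA, hAapp, Finset.sum_coe_sort _ (fun j => c j • u j)]
        symm
        refine Finset.sum_subset (Finset.subset_univ _) (fun j _ hj => ?_)
        have : c j = 0 := le_antisymm (by simpa using hj) (hc0 j)
        simp [this]
    · rintro ⟨J, -, c, hc, rfl⟩
      obtain ⟨c', h1, h2, h3⟩ := hext J c
      refine ⟨c', fun j => ?_, h3.symm⟩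
      by_cases hj : j ∈ J
      · exact (h1 ⟨j, hj⟩).symm ▸ (hc ⟨j, hj⟩).le
      · exact (h2 j hj).ge
  · intro J hJ J' hJ' hne
    rw [Function.onFun, Set.disjoint_left]
    rintro x ⟨c, hc, hx⟩ ⟨c', hc', hx'⟩
    apply hne
    obtain ⟨a, ha1, ha2, ha3⟩ := hext J c
    obtain ⟨b, hb1, hb2, hb3⟩ := hext J' c'
    have hnn : ∀ (J : Finset ι) (c : J → ℝ) (a : ι → ℝ), (∀ j, 0 < c j) → (∀ j : J, a j = c j) →
        (∀ j ∉ J, a j = 0) → (∀ j, 0 ≤ a j) ∧ ∀ j, 0 < a j ↔ j ∈ J := by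
      intro J c a hc h1 h2
      refine ⟨fun j => ?_, fun j => ⟨fun h => ?_, fun h => ?_⟩⟩
      · by_cases hj : j ∈ J
        · exact (h1 ⟨j, hj⟩).symm ▸ (hc ⟨j, hj⟩).le
        · exact (h2 j hj).ge
      · by_contra hj
        exact h.ne' (h2 j hj)
      · exact (h1 ⟨j, h⟩).symm ▸ hc ⟨j, h⟩
    obtain ⟨hapos, haJ⟩ := hnn J c a hc ha1 ha2
    obtain ⟨hbpos, hbJ⟩ := hnn J' c' b hc' hb1 hb2
    have hsum : ∑ j, a j • u j = ∑ j, b j • u j := by rw [ha3, hb3, ← hx, ← hx']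
    -- Two minimal representations of one point differ by a relation that is feasible from the
    -- first, and whose negative is feasible from the second.
    have hab : b - a = 0 := by
      refine hzero _ (hJ _ ?_ ?_) (hJ' _ ?_ ?_)
      · simp [sub_smul, hsum]
      · intro j hj
        simpa [ha2 j hj] using hbpos j
      · simp [sub_smul, hsum]
      · intro j hj
        simpa [hb2 j hj] using hapos j
    ext j
    rw [← haJ, ← hbJ, sub_eq_zero.1 hab]

end Decomposition

/-! ### Rational vectors and lattices -/

/-- The real line is a rational vector space, so the line through a splits off. Applied to the
coefficients, such a functional turns real linear relations between rational vectors into rational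
ones. -/
theorem exists_rat_retraction (a : ℝ) (ha : a ≠ 0) : ∃ ρ : ℝ →ₗ[ℚ] ℚ, ρ a = 1 := by
  have hinj : LinearMap.ker (LinearMap.toSpanSingleton ℚ ℝ a) = ⊥ :=
    LinearMap.ker_toSpanSingleton ℚ ha
  obtain ⟨ρ, hρ⟩ := LinearMap.exists_leftInverse_of_injective _ hinj
  refine ⟨ρ, ?_⟩
  have := LinearMap.congr_fun hρ 1
  simpa using this

theorem rat_linear_relation {ι : Type*} [Fintype ι] {b : ι → RInf} (hb : ∀ i, IsRat (b i))
    {t : ι → ℝ} {x : RInf} (hx : IsRat x) {a : ℝ} (h : a • x = ∑ i, t i • b i) (ρ : ℝ →ₗ[ℚ] ℚ) :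
    (ρ a : ℝ) • x = ∑ i, (ρ (t i) : ℝ) • b i := by
  ext k
  obtain ⟨q, hq⟩ := hx k
  choose p hp using fun i => hb i k
  have h1 := DFunLike.congr_fun h k
  simp only [Finsupp.smul_apply, Finsupp.finsetSum_apply, smul_eq_mul, hq, hp] at h1 ⊢
  have key : ∀ (s : ℝ) (q : ℚ), ρ (s * q) = ρ s * q := by
    intro s q
    rw [mul_comm, ← Rat.smul_def, map_smul, smul_eq_mul, mul_comm]
  have h2 := congrArg ρ h1
  rw [map_sum, key] at h2
  simp only [key] at h2
  exact_mod_cast h2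

/-- A real relation with some nonzero coefficient is carried by a rational functional normalized at
this coefficient to a nontrivial rational relation. -/
theorem linearIndependent_real_of_int {ι : Type*} [Fintype ι] {b : ι → RInf}
    (hb : ∀ i, IsRat (b i)) (hli : LinearIndependent ℤ b) : LinearIndependent ℝ b := by
  rw [LinearIndependent.iff_fractionRing ℤ ℚ] at hli
  rw [Fintype.linearIndependent_iff] at hli ⊢
  intro t ht i
  by_contra hti
  obtain ⟨ρ, hρ⟩ := exists_rat_retraction (t i) hti
  have h := rat_linear_relation (a := 0) (x := 0) hb (fun _ => ⟨0, by simp⟩)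
    (show (0 : ℝ) • (0 : RInf) = ∑ i, t i • b i by rw [ht, smul_zero]) ρ
  rw [smul_zero] at h
  have := hli (fun i => ρ (t i)) (by rw [h]; exact Finset.sum_congr rfl fun i _ => rfl) i
  simp [hρ] at this

/-- The functional with value 1 at 1 replaces the real coordinates of x by rational ones; the
product of their denominators then serves as N. -/
theorem exists_nsmul_mem_of_mem_span {Λ : Submodule ℤ RInf} (hΛ : ∀ v ∈ Λ, IsRat v) {d : ℕ}
    {b : Fin d → RInf} (hb : IsLatticeBasis Λ b) {x : RInf} (hx : IsRat x)
    (hxs : x ∈ Submodule.span ℝ (Set.range b)) : ∃ N : ℕ, 0 < N ∧ (N : ℝ) • x ∈ Λ := by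
  have hbΛ : ∀ i, b i ∈ Λ := fun i => hb.2 ▸ Submodule.subset_span ⟨i, rfl⟩
  obtain ⟨t, ht⟩ := (Submodule.mem_span_range_iff_exists_fun ℝ).1 hxs
  obtain ⟨ρ, hρ⟩ := exists_rat_retraction 1 one_ne_zero
  have h := rat_linear_relation (fun i => hΛ _ (hbΛ i)) hx (by rw [one_smul, ht]) ρ (t := t)
  rw [hρ, Rat.cast_one, one_smul] at h
  set q : Fin d → ℚ := fun i => ρ (t i)
  refine ⟨∏ i, (q i).den, Finset.prod_pos fun i _ => (q i).den_pos, ?_⟩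
  rw [h, Finset.smul_sum]
  refine Λ.sum_mem fun i _ => ?_
  have : ((∏ j, (q j).den : ℕ) : ℝ) • ((q i : ℝ) • b i) =
      (((∏ j ∈ Finset.univ.erase i, (q j).den : ℕ) : ℤ) * (q i).num) • b i := by
    rw [← Finset.mul_prod_erase _ _ (Finset.mem_univ i), smul_smul, ← Int.cast_smul_eq_zsmul ℝ]
    congr 1
    push_cast
    have : (((q i).den : ℝ)) * (q i : ℝ) = (q i).num := by exact_mod_cast Rat.den_mul_eq_num (q i)
    rw [← this]
    ring
  rw [this]
  exact Λ.smul_mem _ (hbΛ i)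

theorem exists_isLatticeBasis {Λ : Submodule ℤ RInf} (hΛ : ∀ v ∈ Λ, IsRat v) (hfg : Λ.FG) :
    ∃ (d : ℕ) (b : Fin d → RInf), IsLatticeBasis Λ b := by
  have : Module.Finite ℤ Λ := Module.Finite.iff_fg.2 hfg
  have : Module.IsTorsionFree ℤ Λ := inferInstance
  have : Module.Free ℤ Λ := inferInstance
  let B := Module.finBasis ℤ Λ
  refine ⟨_, fun i => (B i : RInf), ?_, ?_⟩
  · refine linearIndependent_real_of_int (fun i => hΛ _ (B i).2) ?_
    exact B.linearIndependent.map' Λ.subtype Λ.ker_subtype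
  · have := congrArg (Submodule.map Λ.subtype) B.span_eq
    rw [Submodule.map_span, ← Set.range_comp, Submodule.map_top, Submodule.range_subtype] at this
    exact this

/-! ### Closed and open cones of a finite family of vectors. -/

section ClosedCone

variable {V : Type*} [AddCommGroup V] [Module ℝ V] {ι : Type*} [Fintype ι] {u : ι → V}

theorem closedCone_add {x y : V} (hx : x ∈ closedCone u) (hy : y ∈ closedCone u) :
    x + y ∈ closedCone u := by
  obtain ⟨c, hc, rfl⟩ := hx
  obtain ⟨c', hc', rfl⟩ := hy
  exact ⟨c + c', fun j => add_nonneg (hc j) (hc' j), by simp [add_smul, Finset.sum_add_distrib]⟩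

theorem closedCone_smul {x : V} (hx : x ∈ closedCone u) {a : ℝ} (ha : 0 ≤ a) :
    a • x ∈ closedCone u := by
  obtain ⟨c, hc, rfl⟩ := hx
  exact ⟨a • c, fun j => mul_nonneg ha (hc j), by simp [Finset.smul_sum, smul_smul]⟩

theorem mem_closedCone (j : ι) : u j ∈ closedCone u := by
  classical
  exact ⟨Pi.single j 1, fun i => by by_cases h : i = j <;> simp [h],
    by simp [Pi.single_apply, ite_smul]⟩

theorem openCone_subset_closedCone : openCone u ⊆ closedCone u := by
  rintro x ⟨c, hc, rfl⟩
  exact ⟨c, fun j => (hc j).le, rfl⟩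

theorem closedCone_subset_span : closedCone u ⊆ Submodule.span ℝ (Set.range u) := by
  rintro x ⟨c, -, rfl⟩
  exact Submodule.sum_mem _ fun j _ => Submodule.smul_mem _ _ (Submodule.subset_span ⟨j, rfl⟩)

theorem span_closedCone : Submodule.span ℝ (closedCone u) = Submodule.span ℝ (Set.range u) := by
  refine le_antisymm (Submodule.span_le.2 closedCone_subset_span) (Submodule.span_mono ?_)
  rintro _ ⟨j, rfl⟩
  exact mem_closedCone j

theorem closedCone_smul_generators {w : ι → ℝ} (hw : ∀ j, 0 < w j) :
    closedCone (fun j => w j • u j) = closedCone u := by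
  ext x
  constructor
  · rintro ⟨c, hc, rfl⟩
    exact ⟨fun j => c j * w j, fun j => mul_nonneg (hc j) (hw j).le, by simp [smul_smul]⟩
  · rintro ⟨c, hc, rfl⟩
    refine ⟨fun j => c j / w j, fun j => div_nonneg (hc j) (hw j).le,
      Finset.sum_congr rfl fun j _ => ?_⟩
    rw [smul_smul, div_mul_cancel₀ _ (hw j).ne']

theorem openCone_comp_equiv {κ : Type*} [Fintype κ] (e : κ ≃ ι) :
    openCone (u ∘ e) = openCone u := by
  ext x
  constructor
  · rintro ⟨c, hc, rfl⟩
    refine ⟨c ∘ e.symm, fun j => hc _, ?_⟩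
    rw [← e.sum_comp]
    simp
  · rintro ⟨c, hc, rfl⟩
    refine ⟨c ∘ e, fun j => hc _, ?_⟩
    rw [← e.sum_comp]
    rfl

/-- An open cone is absorbed by the closed cone in the direction opposite to any of its points. -/
theorem exists_sub_smul_mem_closedCone {x y : V} (hx : x ∈ openCone u) (hy : y ∈ closedCone u) :
    ∃ ε : ℝ, 0 < ε ∧ x - ε • y ∈ closedCone u := by
  obtain ⟨c, hc, rfl⟩ := hx
  obtain ⟨c', hc', rfl⟩ := hy
  obtain ⟨ε, hε, h⟩ := exists_pos_forall_add_mul_nonneg c (-c') (fun j => Or.inl (hc j))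
  refine ⟨ε, hε, fun j => c j + ε * (-c') j, h, ?_⟩
  simp [Finset.smul_sum, smul_smul, add_smul, sub_eq_add_neg, Finset.sum_add_distrib]

end ClosedCone

/-! ### Simplicial subdivisions of lattice cones. -/

namespace LatticeCone

variable (C : LatticeCone)

theorem lattice_fg : C.lattice.FG := by
  obtain ⟨d, b, hb, -⟩ := C.isLattice
  rw [← hb.2]
  exact Submodule.fg_span (Set.finite_range b)

theorem span_lattice : Submodule.span ℝ (C.lattice : Set RInf) = Submodule.span ℝ C.cone := by
  obtain ⟨d, b, hb, hs⟩ := C.isLattice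
  rw [← hs]
  refine le_antisymm (Submodule.span_le.2 fun x hx => ?_) (Submodule.span_mono ?_)
  · rw [← hb.2] at hx
    exact Submodule.span_subset_span ℤ ℝ _ hx
  · rintro _ ⟨i, rfl⟩
    exact hb.2 ▸ Submodule.subset_span ⟨i, rfl⟩

theorem span_basis {d : ℕ} {b : Fin d → RInf} (hb : IsLatticeBasis C.lattice b) :
    Submodule.span ℝ (Set.range b) = Submodule.span ℝ C.cone := by
  rw [← span_lattice, ← hb.2]
  exact (Submodule.span_span_of_tower ℤ ℝ _).symm

theorem exists_generators : ∃ (n : ℕ) (u : Fin n → RInf), (∀ j, u j ∈ C.lattice) ∧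
    C.cone = closedCone u := by
  obtain ⟨n, u, hu, hC⟩ := C.polyhedral
  have hC : C.cone = closedCone u := hC
  obtain ⟨d, b, hb, hs⟩ := C.isLattice
  have : ∀ j, ∃ N : ℕ, 0 < N ∧ (N : ℝ) • u j ∈ C.lattice := fun j =>
    exists_nsmul_mem_of_mem_span C.lattice_rat hb (hu j) (by
      rw [hs, hC]
      exact Submodule.subset_span (mem_closedCone j))
  choose N hN hNu using this
  refine ⟨n, fun j => (N j : ℝ) • u j, hNu, ?_⟩
  rw [hC, closedCone_smul_generators]
  exact fun j => by exact_mod_cast hN j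

variable {C}

theorem add_mem_cone {x y : RInf} (hx : x ∈ C.cone) (hy : y ∈ C.cone) : x + y ∈ C.cone := by
  obtain ⟨n, u, -, hC⟩ := C.polyhedral
  have hC : C.cone = closedCone u := hC
  rw [hC] at hx hy ⊢
  exact closedCone_add hx hy

theorem smul_mem_cone {x : RInf} (hx : x ∈ C.cone) {a : ℝ} (ha : 0 ≤ a) : a • x ∈ C.cone := by
  obtain ⟨n, u, -, hC⟩ := C.polyhedral
  have hC : C.cone = closedCone u := hC
  rw [hC] at hx ⊢
  exact closedCone_smul hx ha

theorem convex_cone : Convex ℝ C.cone :=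
  fun _ hx _ hy _ _ ha hb _ => add_mem_cone (smul_mem_cone hx ha) (smul_mem_cone hy hb)

theorem interior_subset : C.interior ⊆ C.cone := fun _ h => h.1

theorem add_mem_interior {x y : RInf} (hx : x ∈ C.interior) (hy : y ∈ C.cone) :
    x + y ∈ C.interior := by
  refine ⟨add_mem_cone hx.1 hy, fun w hw => ?_⟩
  obtain ⟨ε, hε, h⟩ := hx.2 w hw
  refine ⟨ε, hε, ?_⟩
  rw [add_sub_right_comm]
  exact add_mem_cone h hy

/-- If x lies in both sets and y in the open cone, then y is the sum of `ε • x`, which is interior,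
and of `y - ε • x`, which stays in the closed cone for small ε. -/
theorem openCone_subset_interior {ι : Type*} [Fintype ι] {u : ι → RInf}
    (hu : closedCone u ⊆ C.cone) (hne : (openCone u ∩ C.interior).Nonempty) :
    openCone u ⊆ C.interior := by
  obtain ⟨x, hx, hxC⟩ := hne
  intro y hy
  obtain ⟨ε, hε, h⟩ := exists_sub_smul_mem_closedCone hy (openCone_subset_closedCone hx)
  have hx' : ε • x ∈ C.interior := by
    refine ⟨smul_mem_cone hxC.1 hε.le, fun w hw => ?_⟩
    obtain ⟨δ, hδ, h'⟩ := hxC.2 w hw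
    refine ⟨ε * δ, mul_pos hε hδ, ?_⟩
    rw [mul_smul, ← smul_sub]
    exact smul_mem_cone h' hε.le
  have := add_mem_interior hx' (hu h)
  simpa using this

variable (C)

/-- The lattice cone generated by linearly independent vectors of the lattice of `C`, with the
lattice induced by `C`. -/
def simplicial {r : ℕ} (v : Fin r → RInf) (hv : ∀ j, v j ∈ C.lattice) : LatticeCone where
  cone := closedCone v
  lattice := C.lattice ⊓ (Submodule.span ℝ (closedCone v)).restrictScalars ℤ
  polyhedral := ⟨r, v, fun j => C.lattice_rat _ (hv j), rfl⟩
  lattice_rat := fun x hx => C.lattice_rat x hx.1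
  isLattice := by
    have hfg : (C.lattice ⊓ (Submodule.span ℝ (closedCone v)).restrictScalars ℤ).FG :=
      have : IsNoetherian ℤ C.lattice := isNoetherian_of_fg_of_noetherian _ C.lattice_fg
      Submodule.FG.of_le C.lattice_fg inf_le_left
    obtain ⟨d, b, hb⟩ := exists_isLatticeBasis
      (fun x hx => C.lattice_rat x (Submodule.mem_inf.1 hx).1) hfg
    refine ⟨d, b, hb, le_antisymm (Submodule.span_le.2 ?_) ?_⟩
    · rintro _ ⟨i, rfl⟩
      have : b i ∈ C.lattice ⊓ (Submodule.span ℝ (closedCone v)).restrictScalars ℤ :=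
        hb.2 ▸ Submodule.subset_span ⟨i, rfl⟩
      exact this.2
    · rw [span_closedCone]
      refine Submodule.span_le.2 ?_
      rintro _ ⟨j, rfl⟩
      refine Submodule.span_subset_span ℤ ℝ _ ?_
      rw [hb.2]
      exact ⟨hv j, Submodule.subset_span (mem_closedCone j)⟩

variable {C}

theorem simplicial_stronglyConvex {r : ℕ} {v : Fin r → RInf} (hli : LinearIndependent ℝ v)
    (hv : ∀ j, v j ∈ C.lattice) : (C.simplicial v hv).StronglyConvex := by
  rintro x ⟨c, hc, rfl⟩ ⟨c', hc', h⟩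
  have h0 : ∑ j, (c j + c' j) • v j = 0 := by
    simp only [add_smul, Finset.sum_add_distrib, ← h, add_neg_cancel]
  have := Fintype.linearIndependent_iff.1 hli _ h0
  refine Finset.sum_eq_zero fun j _ => ?_
  have h1 := hc j
  have h2 := hc' j
  have h3 := this j
  rw [show c j = 0 by linarith, zero_smul]

/-- One can move a little in the direction opposite to a generator exactly when its coefficient is
positive. -/
theorem simplicial_interior {r : ℕ} {v : Fin r → RInf} (hli : LinearIndependent ℝ v)
    (hv : ∀ j, v j ∈ C.lattice) : (C.simplicial v hv).interior = openCone v := by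
  ext x
  constructor
  · rintro ⟨⟨c, hc, rfl⟩, h⟩
    refine ⟨c, fun j => ?_, rfl⟩
    obtain ⟨ε, hε, c', hc', h'⟩ := h _ (mem_closedCone j)
    have h0 : ∑ i, (c i - ε * (Pi.single j 1 : Fin r → ℝ) i - c' i) • v i = 0 := by
      simp only [sub_smul, Finset.sum_sub_distrib, ← h', mul_smul, ← Finset.smul_sum]
      simp [Pi.single_apply, ite_smul]
    have := Fintype.linearIndependent_iff.1 hli _ h0 j
    have h1 := hc' j
    simp at this
    linarith
  · exact fun hx => ⟨openCone_subset_closedCone hx, fun y hy => exists_sub_smul_mem_closedCone hx hy⟩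

variable (C)

/-- Each open simplicial cone of the partition of C lies in the interior or misses it, by
`openCone_subset_interior`; keep those that meet it. -/
theorem exists_simplicial_decomposition : ∃ (κ : Type) (_ : Fintype κ) (r : κ → ℕ)
    (v : ∀ k, Fin (r k) → RInf), (∀ k, LinearIndependent ℝ (v k)) ∧ (∀ k j, v k j ∈ C.lattice) ∧
    C.interior = ⋃ k, openCone (v k) ∧ Pairwise fun k k' => Disjoint (openCone (v k)) (openCone (v k')) := by
  classical
  obtain ⟨n, u, hu, hC⟩ := C.exists_generators
  obtain ⟨𝒥, hli, hcov, hdisj⟩ := exists_simplicial_partition u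
  set κ := {J : Finset (Fin n) // J ∈ 𝒥 ∧ (openCone (fun j : J => u j) ∩ C.interior).Nonempty}
  have hv : ∀ k : κ, openCone (fun i => u (k.1.equivFin.symm i)) = openCone (fun j : k.1 => u j) :=
    fun k => openCone_comp_equiv (u := fun j : k.1 => u j) k.1.equivFin.symm
  refine ⟨κ, Fintype.ofFinite κ, fun k => k.1.card, fun k i => u (k.1.equivFin.symm i), fun k => ?_,
    fun k j => hu _, ?_, fun k k' hne => ?_⟩
  · exact (hli k.1 k.2.1).comp _ k.1.equivFin.symm.injective
  · simp only [hv]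
    refine subset_antisymm (fun x hx => ?_) (Set.iUnion_subset fun k => ?_)
    · have hx' := hx.1
      rw [hC, hcov] at hx'
      simp only [Set.mem_iUnion] at hx' ⊢
      obtain ⟨J, hJ, hxJ⟩ := hx'
      exact ⟨⟨J, hJ, x, hxJ, hx⟩, hxJ⟩
    · refine openCone_subset_interior ?_ k.2.2
      rintro x ⟨c, hc, rfl⟩
      rw [hC]
      refine ⟨fun j => if h : j ∈ k.1 then c ⟨j, h⟩ else 0, fun j => ?_, ?_⟩
      · by_cases h : j ∈ k.1
        · simpa [h] using hc ⟨j, h⟩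
        · simp [h]
      · rw [← Finset.sum_subset (Finset.subset_univ k.1) (fun j _ hj => by simp [hj]),
          ← Finset.sum_coe_sort k.1]
        exact Finset.sum_congr rfl (fun j _ => by simp)
  · simp only [hv]
    exact hdisj k.2.1 k'.2.1 (fun h => hne (Subtype.ext h))

theorem exists_simplicial_subdivision : ∃ P : Finset LatticeCone, C.IsSubdivision P ∧
    ∀ D ∈ P, ∃ (r : ℕ) (v : Fin r → RInf) (hv : ∀ j, v j ∈ C.lattice), LinearIndependent ℝ v ∧
      D = C.simplicial v hv := by
  classical
  obtain ⟨κ, _, r, v, hli, hv, hcov, hdisj⟩ := C.exists_simplicial_decomposition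
  refine ⟨Finset.univ.image fun k => C.simplicial (v k) (hv k), ⟨?_, ?_, ?_, ?_⟩, ?_⟩
  · simp only [Finset.mem_image, Finset.mem_univ, true_and]
    rintro _ ⟨k, rfl⟩
    exact simplicial_stronglyConvex (hli k) (hv k)
  · simp [hcov, simplicial_interior (hli _) (hv _)]
  · simp only [Finset.coe_image, Finset.coe_univ, Set.image_univ]
    rintro _ ⟨k, rfl⟩ _ ⟨k', rfl⟩ hne
    rw [Function.onFun, simplicial_interior (hli _) (hv _), simplicial_interior (hli _) (hv _)]
    exact hdisj fun h => hne (by rw [h])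
  · simp only [Finset.mem_image, Finset.mem_univ, true_and]
    rintro _ ⟨k, rfl⟩ x
    exact Iff.rfl
  · simp only [Finset.mem_image, Finset.mem_univ, true_and]
    rintro _ ⟨k, rfl⟩
    exact ⟨_, v k, hv k, hli k, rfl⟩

end LatticeCone

/-! ### Extension of a translation-equivariant functional by difference operators -/

section Regularization

variable {V : Type*} [AddCommGroup V]

/-- The relation `ρ f v` is the graph of a partially defined additive functional, which is
multiplied by `e u` under translation by `u ∈ A`. -/
structure IsEquivariant (ρ : (V → ℂ) → ℂ → Prop) (A : Set V) (e : V → ℂ) : Prop where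
  zero : ρ 0 0
  eq_zero : ∀ v, ρ 0 v → v = 0
  add : ∀ f g v w, ρ f v → ρ g w → ρ (f + g) (v + w)
  sub : ∀ f g v w, ρ f v → ρ g w → ρ (f - g) (v - w)
  shift : ∀ u ∈ A, ∀ f v, ρ f v → ρ (fun x => f (x - u)) (e u * v)

/-- The difference operator `f ↦ f - f(· - u)`. -/
def diffOp (u : V) (f : V → ℂ) : V → ℂ := fun x => f x - f (x - u)

/-- The composition of the difference operators of a list of vectors. -/
def diffOps (l : List V) (f : V → ℂ) : V → ℂ := l.foldr diffOp f

theorem diffOps_add (l : List V) (f g : V → ℂ) : diffOps l (f + g) = diffOps l f + diffOps l g := by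
  induction l with
  | nil => rfl
  | cons u l ih =>
    change diffOp u (diffOps l (f + g)) = diffOp u (diffOps l f) + diffOp u (diffOps l g)
    rw [ih]
    ext x
    simp only [diffOp, Pi.add_apply]
    ring

theorem diffOps_sub (l : List V) (f g : V → ℂ) : diffOps l (f - g) = diffOps l f - diffOps l g := by
  induction l with
  | nil => rfl
  | cons u l ih =>
    change diffOp u (diffOps l (f - g)) = diffOp u (diffOps l f) - diffOp u (diffOps l g)
    rw [ih]
    ext x
    simp only [diffOp, Pi.sub_apply]
    ring

theorem diffOps_zero (l : List V) : diffOps l (0 : V → ℂ) = 0 := by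
  simpa using diffOps_sub l 0 0

theorem diffOps_append (l l' : List V) (f : V → ℂ) :
    diffOps (l ++ l') f = diffOps l (diffOps l' f) := List.foldr_append

instance : LeftCommutative (diffOp (V := V)) where
  left_comm u w f := by
    ext x
    simp only [diffOp, sub_right_comm x u w]
    ring

theorem diffOps_comm (l l' : List V) (f : V → ℂ) :
    diffOps l (diffOps l' f) = diffOps l' (diffOps l f) := by
  rw [← diffOps_append, ← diffOps_append]
  exact List.perm_append_comm.foldr_eq f

/-- The functional `ρ`, extended to the functions `f` that difference operators, each acting
invertibly on values, map to the domain of `ρ`. -/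
def RegValue (ρ : (V → ℂ) → ℂ → Prop) (A : Set V) (e : V → ℂ) (f : V → ℂ) (v : ℂ) : Prop :=
  ∃ l : List V, (∀ u ∈ l, u ∈ A ∧ e u ≠ 1) ∧ ρ (diffOps l f) ((l.map fun u => 1 - e u).prod * v)

variable {ρ : (V → ℂ) → ℂ → Prop} {A : Set V} {e : V → ℂ}

theorem RegValue.of_value {f : V → ℂ} {v : ℂ} (h : ρ f v) : RegValue ρ A e f v :=
  ⟨[], by simp, by simpa [diffOps] using h⟩

theorem IsEquivariant.diffOps (hρ : IsEquivariant ρ A e) {l : List V} (hl : ∀ u ∈ l, u ∈ A)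
    {f : V → ℂ} {v : ℂ} (h : ρ f v) :
    ρ (ConeLocality.diffOps l f) ((l.map fun u => 1 - e u).prod * v) := by
  induction l with
  | nil => simpa [ConeLocality.diffOps] using h
  | cons u l ih =>
    have h1 := ih fun w hw => hl w (List.mem_cons_of_mem _ hw)
    have h2 := hρ.sub _ _ _ _ h1 (hρ.shift u (hl u List.mem_cons_self) _ _ h1)
    rw [List.map_cons, List.prod_cons, mul_assoc, sub_mul, one_mul]
    exact h2

/-- Apply to each function also the operators chosen for the other: the concatenated list works for
both, because difference operators commute. -/
theorem RegValue.add (hρ : IsEquivariant ρ A e) {f g : V → ℂ} {v w : ℂ}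
    (hf : RegValue ρ A e f v) (hg : RegValue ρ A e g w) : RegValue ρ A e (f + g) (v + w) := by
  obtain ⟨l, hl, h⟩ := hf
  obtain ⟨l', hl', h'⟩ := hg
  refine ⟨l' ++ l, fun u hu => ?_, ?_⟩
  · rcases List.mem_append.1 hu with hu | hu
    exacts [hl' u hu, hl u hu]
  · have h1 := hρ.diffOps (fun u hu => (hl' u hu).1) h
    have h2 := hρ.diffOps (fun u hu => (hl u hu).1) h'
    rw [diffOps_comm] at h2
    have h3 := hρ.add _ _ _ _ h1 h2
    rw [diffOps_append, diffOps_add, diffOps_add]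
    convert h3 using 1
    rw [List.map_append, List.prod_append]
    ring

/-- Here the condition `e u ≠ 1` enters: the product of the factors `1 - e u` can be cancelled. -/
theorem RegValue.eq_zero (hρ : IsEquivariant ρ A e) {v : ℂ} (h : RegValue ρ A e 0 v) : v = 0 := by
  obtain ⟨l, hl, h⟩ := h
  rw [diffOps_zero] at h
  have := hρ.eq_zero _ h
  refine (mul_eq_zero.1 this).resolve_left fun h0 => ?_
  obtain ⟨u, hu, h1⟩ := List.mem_map.1 (List.prod_eq_zero_iff.1 h0)
  exact (hl u hu).2 (sub_eq_zero.1 h1).symm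

theorem RegValue.neg (hρ : IsEquivariant ρ A e) {f : V → ℂ} {v : ℂ} (hf : RegValue ρ A e f v) :
    RegValue ρ A e (-f) (-v) := by
  obtain ⟨l, hl, h⟩ := hf
  refine ⟨l, hl, ?_⟩
  have := hρ.sub _ _ _ _ hρ.zero h
  rw [← zero_sub, diffOps_sub, diffOps_zero]
  convert this using 1
  ring

theorem RegValue.unique (hρ : IsEquivariant ρ A e) {f : V → ℂ} {v w : ℂ}
    (hv : RegValue ρ A e f v) (hw : RegValue ρ A e f w) : v = w := by
  have h := hv.add hρ (hw.neg hρ)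
  rw [add_neg_cancel] at h
  exact add_neg_eq_zero.1 (h.eq_zero hρ)

theorem RegValue.sum (hρ : IsEquivariant ρ A e) {κ : Type*} (s : Finset κ) {f : κ → V → ℂ}
    {v : κ → ℂ} (h : ∀ k ∈ s, RegValue ρ A e (f k) (v k)) :
    RegValue ρ A e (∑ k ∈ s, f k) (∑ k ∈ s, v k) := by
  classical
  induction s using Finset.induction_on with
  | empty => simpa using RegValue.of_value hρ.zero
  | insert k s hk ih =>
    rw [Finset.sum_insert hk, Finset.sum_insert hk]
    exact (h k (Finset.mem_insert_self k s)).add hρ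
      (ih fun k' hk' => h k' (Finset.mem_insert_of_mem hk'))

/-- When X contains its translate by u, the difference of the indicator functions is the indicator
function of X minus the translate. -/
theorem diffOp_indicator {X Y : Set V} {u : V} (hX : ∀ x, x - u ∈ X → x ∈ X)
    (hY : ∀ x, x ∈ Y ↔ x ∈ X ∧ x - u ∉ X) : diffOp u (X.indicator 1) = Y.indicator 1 := by
  ext x
  by_cases h1 : x ∈ X <;> by_cases h2 : x - u ∈ X
  · simp [diffOp, h1, h2, hY]
  · simp [diffOp, h1, h2, hY]
  · exact absurd (hX x h2) h1
  · simp [diffOp, h1, h2, hY]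

end Regularization

/-! ### The difference operators of a basis on the indicator function of an open cone -/

section Box

variable {V : Type*} [AddCommGroup V] [Module ℝ V]

/-- The half-open parallelepiped spanned by a family of vectors. -/
def halfOpenBox {ι : Type*} [Fintype ι] (v : ι → V) : Set V :=
  {x | ∃ c : ι → ℝ, (∀ j, 0 < c j ∧ c j ≤ 1) ∧ x = ∑ j, c j • v j}

theorem diffOps_indicator_openCone {r : ℕ} {v : Fin r → V} (hv : LinearIndependent ℝ v)
    {Λ : AddSubgroup V} (hΛ : ∀ j, v j ∈ Λ) :
    diffOps (List.ofFn v) ((openCone v ∩ Λ).indicator 1) = (halfOpenBox v ∩ Λ).indicator 1 := by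
  -- The intermediate stage, where the operators of s have been applied: coordinates in s run over
  -- (0, 1], the others over (0, ∞). Each operator cuts one more coordinate, since `c > 0` together
  -- with the failure of `c - 1 > 0` means `0 < c ≤ 1`.
  set X : Finset (Fin r) → Set V := fun s =>
    {x | (∃ c : Fin r → ℝ, (∀ j, 0 < c j ∧ (j ∈ s → c j ≤ 1)) ∧ x = ∑ j, c j • v j) ∧ x ∈ Λ}
  have huniq : ∀ c c' : Fin r → ℝ, ∑ j, c j • v j = ∑ j, c' j • v j → c = c' := by
    intro c c' h
    have := Fintype.linearIndependent_iff.1 hv (c - c') (by simp [sub_smul, h])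
    ext j
    exact sub_eq_zero.1 (this j)
  have hshift : ∀ (c : Fin r → ℝ) (k : Fin r),
      (∑ j, c j • v j) - v k = ∑ j, (c - Pi.single k 1 : Fin r → ℝ) j • v j := by
    intro c k
    simp [sub_smul, Pi.single_apply, ite_smul]
  have key : ∀ (s : Finset (Fin r)) (k : Fin r), k ∉ s →
      diffOp (v k) ((X s).indicator 1) = (X (insert k s)).indicator 1 := by
    intro s k hk
    refine diffOp_indicator ?_ fun x => ⟨?_, ?_⟩
    · rintro x ⟨⟨c, hc, hx⟩, hxΛ⟩
      refine ⟨⟨c + Pi.single k 1, fun j => ?_, ?_⟩, ?_⟩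
      · by_cases hj : j = k
        · subst hj
          exact ⟨by simpa using add_pos (hc j).1 one_pos, fun h => absurd h hk⟩
        · simpa [hj] using hc j
      · rw [sub_eq_iff_eq_add.1 hx]
        simp [add_smul, Finset.sum_add_distrib, Pi.single_apply, ite_smul]
      · simpa using Λ.add_mem hxΛ (hΛ k)
    · rintro ⟨⟨c, hc, rfl⟩, hxΛ⟩
      refine ⟨⟨⟨c, fun j => ⟨(hc j).1, fun h => (hc j).2 (Finset.mem_insert_of_mem h)⟩, rfl⟩, hxΛ⟩, ?_⟩
      rintro ⟨⟨c', hc', hx'⟩, -⟩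
      rw [hshift] at hx'
      have h1 := congrFun (huniq _ _ hx') k
      have h2 := (hc k).2 (Finset.mem_insert_self k s)
      have h3 := (hc' k).1
      simp at h1
      linarith
    · rintro ⟨⟨⟨c, hc, rfl⟩, hxΛ⟩, h⟩
      refine ⟨⟨c, fun j => ⟨(hc j).1, fun hj => ?_⟩, rfl⟩, hxΛ⟩
      rcases Finset.mem_insert.1 hj with rfl | hj
      · by_contra hlt
        push Not at hlt
        refine h ⟨⟨_, fun i => ?_, hshift c j⟩, Λ.sub_mem hxΛ (hΛ j)⟩
        by_cases hi : i = j
        · subst hi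
          exact ⟨by simpa using hlt, fun h => absurd h hk⟩
        · simpa [hi] using hc i
      · exact (hc j).2 hj
  have hlist : ∀ l : List (Fin r), l.Nodup →
      diffOps (l.map v) ((X ∅).indicator 1) = (X l.toFinset).indicator 1 := by
    intro l hl
    induction l with
    | nil => rfl
    | cons k l ih =>
      rw [List.nodup_cons] at hl
      change diffOp (v k) (diffOps (l.map v) _) = _
      rw [ih hl.2, key _ k (by simpa using hl.1), List.toFinset_cons]
  have h := hlist (List.finRange r) (List.nodup_finRange r)
  have h0 : X ∅ = openCone v ∩ Λ := by
    ext x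
    simp [X, openCone]
  have h1 : X (List.finRange r).toFinset = halfOpenBox v ∩ Λ := by
    ext x
    simp [X, halfOpenBox]
  rwa [h0, h1, ← List.ofFn_eq_map] at h

end Box

/-! ### Holomorphic germs with rational Taylor coefficients -/

section RationalJets

variable {m : ℕ}

/-- The `i`-th partial derivative. -/
def partialDeriv (i : Fin m) (h : (Fin m → ℂ) → ℂ) : (Fin m → ℂ) → ℂ :=
  fun x => fderiv ℂ h x (Pi.single i 1)

/-- The partial derivatives of `h` at `0` of order at most `n` are rational. -/
def RatJet : ℕ → ((Fin m → ℂ) → ℂ) → Prop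
  | 0, h => ∃ q : ℚ, h 0 = q
  | n + 1, h => (∃ q : ℚ, h 0 = q) ∧ ∀ i, RatJet n (partialDeriv i h)

/-- `h` is holomorphic at `0` and its iterated partial derivatives at `0` are rational. -/
def IsRatAnalytic (h : (Fin m → ℂ) → ℂ) : Prop := AnalyticAt ℂ h 0 ∧ ∀ n, RatJet n h

theorem analyticAt_partialDeriv {h : (Fin m → ℂ) → ℂ} {x : Fin m → ℂ} (hh : AnalyticAt ℂ h x)
    (i : Fin m) : AnalyticAt ℂ (partialDeriv i h) x :=
  ((ContinuousLinearMap.apply ℂ ℂ (Pi.single i 1 : Fin m → ℂ)).analyticAt _).comp hh.fderiv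

theorem partialDeriv_congr {h g : (Fin m → ℂ) → ℂ} (hg : h =ᶠ[𝓝 0] g) (i : Fin m) :
    partialDeriv i h =ᶠ[𝓝 0] partialDeriv i g := by
  filter_upwards [hg.fderiv (𝕜 := ℂ)] with x hx
  rw [partialDeriv, partialDeriv, hx]

theorem RatJet.value {n : ℕ} {h : (Fin m → ℂ) → ℂ} (hh : RatJet n h) : ∃ q : ℚ, h 0 = q := by
  cases n with
  | zero => exact hh
  | succ n => exact hh.1

theorem RatJet.congr {n : ℕ} {h g : (Fin m → ℂ) → ℂ} (hh : RatJet n h) (hg : h =ᶠ[𝓝 0] g) :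
    RatJet n g := by
  induction n generalizing h g with
  | zero =>
    obtain ⟨q, hq⟩ := hh
    exact ⟨q, by rw [← hg.eq_of_nhds, hq]⟩
  | succ n ih =>
    obtain ⟨⟨q, hq⟩, hd⟩ := hh
    exact ⟨⟨q, by rw [← hg.eq_of_nhds, hq]⟩, fun i => ih (hd i) (partialDeriv_congr hg i)⟩

theorem RatJet.of_succ {n : ℕ} {h : (Fin m → ℂ) → ℂ} (hh : RatJet (n + 1) h) : RatJet n h := by
  induction n generalizing h with
  | zero => exact hh.1
  | succ n ih => exact ⟨hh.1, fun i => ih (hh.2 i)⟩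

/-- The recursive form of the rationality condition suits the product and chain rules. Peeling off
the last direction of an iterated derivative matches it with the form used for germs. -/
theorem IsRatAnalytic.isRatHolo {h : (Fin m → ℂ) → ℂ} (hh : IsRatAnalytic h) : IsRatHolo h := by
  refine ⟨hh.1, fun n => ?_⟩
  obtain ⟨ha, hr⟩ := hh
  replace hr := hr n
  induction n generalizing h with
  | zero =>
    intro e
    simpa [RatJet] using hr
  | succ n ih =>
    intro e
    obtain ⟨q, hq⟩ := ih (analyticAt_partialDeriv ha (e (Fin.last n))) (hr.2 _) (Fin.init e)
    refine ⟨q, ?_⟩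
    rw [iteratedFDeriv_succ_apply_right, ← hq]
    have hc : ContDiffAt ℂ n (fderiv ℂ h) 0 := ha.fderiv.contDiffAt
    have := (ContinuousLinearMap.apply ℂ ℂ (Pi.single (e (Fin.last n)) 1 : Fin m → ℂ)).iteratedFDeriv_comp_left
      hc le_rfl
    have h2 : (ContinuousLinearMap.apply ℂ ℂ (Pi.single (e (Fin.last n)) 1 : Fin m → ℂ)) ∘ fderiv ℂ h =
      partialDeriv (e (Fin.last n)) h := rfl
    rw [h2] at this
    rw [this]
    rfl

theorem RatJet.add {n : ℕ} {h g : (Fin m → ℂ) → ℂ} (ha : AnalyticAt ℂ h 0) (hb : AnalyticAt ℂ g 0)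
    (hh : RatJet n h) (hg : RatJet n g) : RatJet n (h + g) := by
  have hval : ∃ q : ℚ, (h + g) 0 = q := by
    obtain ⟨q, hq⟩ := hh.value
    obtain ⟨q', hq'⟩ := hg.value
    exact ⟨q + q', by simp [hq, hq']⟩
  induction n generalizing h g with
  | zero => exact hval
  | succ n ih =>
    refine ⟨hval, fun i => ?_⟩
    have := ih (analyticAt_partialDeriv ha i) (analyticAt_partialDeriv hb i) (hh.2 i) (hg.2 i) (by
      obtain ⟨q, hq⟩ := (hh.2 i).value
      obtain ⟨q', hq'⟩ := (hg.2 i).value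
      exact ⟨q + q', by simp [hq, hq']⟩)
    refine this.congr ?_
    filter_upwards [ha.eventually_analyticAt, hb.eventually_analyticAt] with x hx hy
    simp [partialDeriv, fderiv_add hx.differentiableAt hy.differentiableAt]

theorem RatJet.mul {n : ℕ} {h g : (Fin m → ℂ) → ℂ} (ha : AnalyticAt ℂ h 0) (hb : AnalyticAt ℂ g 0)
    (hh : RatJet n h) (hg : RatJet n g) : RatJet n (h * g) := by
  induction n generalizing h g with
  | zero =>
    obtain ⟨q, hq⟩ := hh
    obtain ⟨q', hq'⟩ := hg
    exact ⟨q * q', by simp [hq, hq']⟩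
  | succ n ih =>
    refine ⟨(ih ha hb hh.of_succ hg.of_succ).value, fun i => ?_⟩
    have h1 := ih ha (analyticAt_partialDeriv hb i) hh.of_succ (hg.2 i)
    have h2 := ih hb (analyticAt_partialDeriv ha i) hg.of_succ (hh.2 i)
    refine (h1.add (ha.mul (analyticAt_partialDeriv hb i)) (hb.mul (analyticAt_partialDeriv ha i))
      h2).congr ?_
    filter_upwards [ha.eventually_analyticAt, hb.eventually_analyticAt] with x hx hy
    simp [partialDeriv, fderiv_mul hx.differentiableAt hy.differentiableAt]

theorem RatJet.const (n : ℕ) (q : ℚ) : RatJet n (fun _ : Fin m → ℂ => (q : ℂ)) := by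
  induction n generalizing q with
  | zero => exact ⟨q, rfl⟩
  | succ n ih =>
    refine ⟨⟨q, rfl⟩, fun i => (ih 0).congr ?_⟩
    filter_upwards with x
    simp [partialDeriv]

theorem IsRatAnalytic.const (q : ℚ) : IsRatAnalytic (fun _ : Fin m → ℂ => (q : ℂ)) :=
  ⟨analyticAt_const, fun n => RatJet.const n q⟩

theorem IsRatAnalytic.add {h g : (Fin m → ℂ) → ℂ} (hh : IsRatAnalytic h) (hg : IsRatAnalytic g) :
    IsRatAnalytic (h + g) :=
  ⟨hh.1.add hg.1, fun n => (hh.2 n).add hh.1 hg.1 (hg.2 n)⟩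

theorem IsRatAnalytic.mul {h g : (Fin m → ℂ) → ℂ} (hh : IsRatAnalytic h) (hg : IsRatAnalytic g) :
    IsRatAnalytic (h * g) :=
  ⟨hh.1.mul hg.1, fun n => (hh.2 n).mul hh.1 hg.1 (hg.2 n)⟩

theorem IsRatAnalytic.sum {κ : Type*} (s : Finset κ) {h : κ → (Fin m → ℂ) → ℂ}
    (hh : ∀ k ∈ s, IsRatAnalytic (h k)) : IsRatAnalytic (∑ k ∈ s, h k) :=
  Finset.sum_induction _ IsRatAnalytic (fun _ _ => IsRatAnalytic.add)
    (by simpa using! IsRatAnalytic.const (m := m) 0) hh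

theorem IsRatAnalytic.prod {κ : Type*} (s : Finset κ) {h : κ → (Fin m → ℂ) → ℂ}
    (hh : ∀ k ∈ s, IsRatAnalytic (h k)) : IsRatAnalytic (∏ k ∈ s, h k) :=
  Finset.prod_induction _ IsRatAnalytic (fun _ _ => IsRatAnalytic.mul)
    (by simpa using! IsRatAnalytic.const (m := m) 1) hh

/-- Since `∂(1/h) = -∂h · (1/h)²`, the jet of order n + 1 of the inverse is determined by its jet of
order n and that of `∂h`. -/
theorem IsRatAnalytic.inv {h : (Fin m → ℂ) → ℂ} (hh : IsRatAnalytic h) (h0 : h 0 ≠ 0) :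
    IsRatAnalytic h⁻¹ := by
  have ha : AnalyticAt ℂ h⁻¹ 0 := hh.1.inv h0
  refine ⟨ha, fun n => ?_⟩
  have hval : ∃ q : ℚ, h⁻¹ 0 = q := by
    obtain ⟨q, hq⟩ := (hh.2 0).value
    exact ⟨q⁻¹, by simp [hq]⟩
  induction n with
  | zero => exact hval
  | succ n ih =>
    refine ⟨hval, fun i => ?_⟩
    have hd := analyticAt_partialDeriv hh.1 i
    have h1 := (RatJet.const (m := m) n (-1)).mul analyticAt_const hd ((hh.2 (n + 1)).2 i)
    have h2 := h1.mul (analyticAt_const.mul hd) (ha.mul ha) (ih.mul ha ha ih)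
    refine h2.congr ?_
    filter_upwards [hh.1.eventually_analyticAt, hh.1.continuousAt.eventually_ne h0] with x hx hx0
    have : fderiv ℂ h⁻¹ x = -(h x ^ 2)⁻¹ • fderiv ℂ h x :=
      ((hasDerivAt_inv hx0).comp_hasFDerivAt x hx.differentiableAt.hasFDerivAt).fderiv
    simp only [partialDeriv, this, Pi.mul_apply, Pi.inv_apply, FunLike.coe_smul,
      Pi.smul_apply, smul_eq_mul]
    push_cast
    field_simp

/-- The linear form with the given coefficients. -/
def coeffForm (a : Fin m → ℚ) (t : Fin m → ℂ) : ℂ := ∑ i, (a i : ℂ) * t i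

theorem hasFDerivAt_coeffForm (a : Fin m → ℚ) (x : Fin m → ℂ) :
    HasFDerivAt (coeffForm a) (∑ i, (a i : ℂ) • ContinuousLinearMap.proj (R := ℂ) (φ := fun _ => ℂ) i) x := by
  have := (∑ i, (a i : ℂ) • ContinuousLinearMap.proj (R := ℂ) (φ := fun _ : Fin m => ℂ) i).hasFDerivAt (x := x)
  convert this using 1
  ext t
  simp [coeffForm]

theorem analyticAt_coeffForm (a : Fin m → ℚ) (x : Fin m → ℂ) : AnalyticAt ℂ (coeffForm a) x := by
  have := (∑ i, (a i : ℂ) • ContinuousLinearMap.proj (R := ℂ) (φ := fun _ : Fin m => ℂ) i).analyticAt x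
  convert this using 1
  ext t
  simp [coeffForm]

theorem coeffForm_zero (a : Fin m → ℚ) : coeffForm a 0 = 0 := by simp [coeffForm]

/-- By the chain rule a partial derivative is a rational multiple of the same construction for the
derivative of φ, which allows induction over all φ. -/
theorem IsRatAnalytic.comp_coeffForm {φ : ℂ → ℂ} (hφ : AnalyticAt ℂ φ 0)
    (hr : ∀ n, ∃ q : ℚ, iteratedDeriv n φ 0 = q) (a : Fin m → ℚ) :
    IsRatAnalytic (fun t => φ (coeffForm a t)) := by
  have hcomp : ∀ {ψ : ℂ → ℂ}, AnalyticAt ℂ ψ 0 → AnalyticAt ℂ (fun t => ψ (coeffForm a t)) 0 :=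
    fun hψ => AnalyticAt.comp (by rwa [coeffForm_zero]) (analyticAt_coeffForm a 0)
  refine ⟨hcomp hφ, fun n => ?_⟩
  induction n generalizing φ with
  | zero => simpa [RatJet, coeffForm_zero] using hr 0
  | succ n ih =>
    refine ⟨by simpa [coeffForm_zero] using hr 0, fun i => ?_⟩
    have h1 := ih hφ.deriv fun k => by simpa [← iteratedDeriv_succ'] using hr (k + 1)
    have h2 := (RatJet.const (m := m) n (a i)).mul analyticAt_const (hcomp hφ.deriv) h1
    refine h2.congr ?_
    have hcont : Tendsto (coeffForm a) (𝓝 0) (𝓝 0) := by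
      simpa [coeffForm_zero] using (analyticAt_coeffForm a 0).continuousAt.tendsto
    filter_upwards [hcont.eventually hφ.eventually_analyticAt] with x hx
    have := (hx.differentiableAt.hasDerivAt.comp_hasFDerivAt x (hasFDerivAt_coeffForm a x)).fderiv
    have h3 : partialDeriv i (fun t => φ (coeffForm a t)) x = _ := congrArg (fun T => T (Pi.single i 1)) this
    rw [h3]
    simp [Pi.single_apply, mul_comm]

theorem IsRatAnalytic.exp (a : Fin m → ℚ) : IsRatAnalytic (fun t => Complex.exp (coeffForm a t)) :=
  IsRatAnalytic.comp_coeffForm analyticAt_cexp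
    (fun n => ⟨1, by simp [iteratedDeriv_eq_iterate, Complex.iter_deriv_exp]⟩) a

theorem IsRatAnalytic.coeffForm (a : Fin m → ℚ) : IsRatAnalytic (coeffForm a) := by
  refine IsRatAnalytic.comp_coeffForm (φ := id) analyticAt_id (fun n => ?_) a
  rw [iteratedDeriv_id]
  by_cases h0 : n = 0
  · exact ⟨0, by simp [h0]⟩
  · by_cases h1 : n = 1
    · exact ⟨1, by simp [h1]⟩
    · exact ⟨0, by simp [h0, h1]⟩

/-- The entire function `(e^w - 1) / w`. -/
def expQuot : ℂ → ℂ := dslope Complex.exp 0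

theorem mul_expQuot (w : ℂ) : w * expQuot w = Complex.exp w - 1 := by
  simpa using! sub_smul_dslope Complex.exp 0 w

theorem expQuot_zero : expQuot 0 = 1 := by simp [expQuot]

theorem differentiable_expQuot : Differentiable ℂ expQuot := by
  have := (Complex.differentiableOn_dslope (f := Complex.exp) (c := 0) (s := Set.univ) univ_mem).2
    Complex.differentiable_exp.differentiableOn
  exact differentiableOn_univ.1 this

/-- Differentiate `w * expQuot w = e^w - 1` exactly n + 1 times. At 0 this gives the rational
derivatives `1 / (n + 1)`. -/
theorem iteratedDeriv_expQuot (n : ℕ) (w : ℂ) :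
    w * iteratedDeriv (n + 1) expQuot w + (n + 1) * iteratedDeriv n expQuot w = Complex.exp w := by
  have hd : ∀ n w, HasDerivAt (iteratedDeriv n expQuot) (iteratedDeriv (n + 1) expQuot w) w := by
    intro n w
    rw [iteratedDeriv_succ]
    have hc : ContDiff ℂ ⊤ expQuot := differentiable_expQuot.contDiff
    exact ((hc.differentiable_iteratedDeriv n (by exact_mod_cast WithTop.coe_lt_top _)) w).hasDerivAt
  induction n generalizing w with
  | zero =>
    have h1 := (hasDerivAt_id w).mul (hd 0 w)
    have h2 : HasDerivAt (fun w => w * expQuot w) (Complex.exp w) w := by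
      simp only [mul_expQuot]
      exact (Complex.hasDerivAt_exp w).sub_const 1
    have := h1.unique (by simpa using! h2)
    simp at this ⊢
    rw [← this]
    ring
  | succ n ih =>
    have h1 := ((hasDerivAt_id w).mul (hd (n + 1) w)).add ((hd n w).const_mul ((n : ℂ) + 1))
    have h2 : HasDerivAt (fun w => w * iteratedDeriv (n + 1) expQuot w +
        (n + 1) * iteratedDeriv n expQuot w) (Complex.exp w) w := by
      simp only [ih]
      exact Complex.hasDerivAt_exp w
    have := h1.unique h2
    simp only [id] at this
    rw [← this]
    push_cast
    ring

theorem IsRatAnalytic.expQuot (a : Fin m → ℚ) :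
    IsRatAnalytic (fun t => expQuot (ConeLocality.coeffForm a t)) := by
  refine IsRatAnalytic.comp_coeffForm (differentiable_expQuot.analyticAt 0) (fun n => ?_) a
  have := iteratedDeriv_expQuot n 0
  rw [zero_mul, zero_add, Complex.exp_zero] at this
  refine ⟨((n : ℚ) + 1)⁻¹, ?_⟩
  push_cast
  exact eq_inv_of_mul_eq_one_right this

end RationalJets

/-! ### The canonical pairing and the filter of pole complements -/

/-- The canonical pairing as a linear map in the first variable. -/
def pairHom (z : DualC) : RInf →ₗ[ℝ] ℂ := Finsupp.lsum ℝ fun i => (LinearMap.toSpanSingleton ℝ ℂ (z i))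

theorem pairHom_apply (x : RInf) (z : DualC) : pairHom z x = pair x z := by
  change (x.sum fun i a => a • z i) = _
  simp [pair, Complex.real_smul]

theorem pair_sum_smul {ι : Type*} [Fintype ι] (c : ι → ℝ) (u : ι → RInf) (z : DualC) :
    pair (∑ j, c j • u j) z = ∑ j, (c j : ℂ) * pair (u j) z := by
  simp [← pairHom_apply]

theorem pair_add (x y : RInf) (z : DualC) : pair (x + y) z = pair x z + pair y z := by
  simp [← pairHom_apply]

theorem continuous_pair (x : RInf) : Continuous (pair x) := by
  unfold pair Finsupp.sum
  fun_prop

theorem pair_at_zero (x : RInf) : pair x 0 = 0 := by simp [pair]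

theorem poleFilter_le_nhds : poleFilter ≤ 𝓝 0 := inf_le_left

theorem eventually_pair_ne_zero {u : RInf} (hu : IsRat u) (h0 : u ≠ 0) :
    ∀ᶠ z in poleFilter, pair u z ≠ 0 := by
  have h : poleFilter ≤ 𝓟 {z | pair u z ≠ 0} := inf_le_right.trans (iInf₂_le u ⟨hu, h0⟩)
  exact h (mem_principal_self _)

theorem tendsto_pair (u : RInf) : Tendsto (pair u) poleFilter (𝓝 0) := by
  have := (continuous_pair u).tendsto 0
  rw [pair_at_zero] at this
  exact this.mono_left poleFilter_le_nhds

/-- In `e^w - 1 = w * expQuot w` the second factor does not vanish near 0, so only the hyperplane of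
u has to be removed. -/
theorem eventually_exp_pair_ne_one {u : RInf} (hu : IsRat u) (h0 : u ≠ 0) :
    ∀ᶠ z in poleFilter, Complex.exp (pair u z) ≠ 1 := by
  have h1 : ∀ᶠ w in 𝓝 (0 : ℂ), expQuot w ≠ 0 :=
    (differentiable_expQuot 0).continuousAt.eventually_ne (by simp [expQuot_zero])
  filter_upwards [eventually_pair_ne_zero hu h0, (tendsto_pair u).eventually h1] with z hz hz'
  rw [← sub_ne_zero, ← mul_expQuot]
  exact mul_ne_zero hz hz'

/-! ### Meromorphic functions with linear poles -/

section Mero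

variable {m : ℕ} {L : Fin m → RInf}

/-- The values of a family of linear forms. -/
def evalForms (L : Fin m → RInf) (z : DualC) : Fin m → ℂ := fun i => pair (L i) z

/-- `G` agrees, off finitely many rational hyperplanes, with a meromorphic germ with linear poles and
rational coefficients in the linear forms `L`. -/
def IsRatMero (L : Fin m → RInf) (G : DualC → ℂ) : Prop :=
  ∃ h : (Fin m → ℂ) → ℂ, IsRatAnalytic h ∧
    ∃ (r : ℕ) (M : Fin r → Fin m → ℚ), (∀ j, ∑ i, (M j i : ℝ) • L i ≠ 0) ∧
      G =ᶠ[poleFilter] fun z => h (evalForms L z) / ∏ j, coeffForm (M j) (evalForms L z)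

theorem IsRatMero.isMeroIn {G : DualC → ℂ} (hG : IsRatMero L G) : IsMeroIn L (G : PoleGerm) := by
  obtain ⟨h, hh, r, M, hM, hG⟩ := hG
  exact ⟨h, hh.isRatHolo, r, M, hM, Germ.coe_eq.2 hG⟩

theorem coeffForm_evalForms (a : Fin m → ℚ) (z : DualC) :
    coeffForm a (evalForms L z) = pair (∑ i, (a i : ℝ) • L i) z := by
  simp [coeffForm, evalForms, pair_sum_smul]

theorem isRat_sum_smul (hL : ∀ i, IsRat (L i)) (a : Fin m → ℚ) : IsRat (∑ i, (a i : ℝ) • L i) := by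
  intro k
  choose q hq using fun i => hL i k
  exact ⟨∑ i, a i * q i, by simp [Finsupp.finsetSum_apply, hq]⟩

theorem eventually_prod_coeffForm_ne_zero (hL : ∀ i, IsRat (L i)) {r : ℕ} {M : Fin r → Fin m → ℚ}
    (hM : ∀ j, ∑ i, (M j i : ℝ) • L i ≠ 0) :
    ∀ᶠ z in poleFilter, ∏ j, coeffForm (M j) (evalForms L z) ≠ 0 := by
  simp only [Finset.prod_ne_zero_iff, Finset.mem_univ, true_imp_iff, coeffForm_evalForms]
  exact eventually_all.2 fun j => eventually_pair_ne_zero (isRat_sum_smul hL _) (hM j)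

theorem IsRatMero.zero : IsRatMero L 0 :=
  ⟨fun _ => (0 : ℚ), IsRatAnalytic.const 0, 0, Fin.elim0, fun j => j.elim0, by
    filter_upwards with z
    simp⟩

theorem IsRatMero.add (hL : ∀ i, IsRat (L i)) {F G : DualC → ℂ} (hF : IsRatMero L F)
    (hG : IsRatMero L G) : IsRatMero L (F + G) := by
  obtain ⟨h, hh, r, M, hM, hF⟩ := hF
  obtain ⟨h', hh', r', M', hM', hG⟩ := hG
  refine ⟨h * (∏ j, coeffForm (M' j)) + h' * ∏ j, coeffForm (M j),
    (hh.mul (IsRatAnalytic.prod _ fun j _ => IsRatAnalytic.coeffForm _)).add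
      (hh'.mul (IsRatAnalytic.prod _ fun j _ => IsRatAnalytic.coeffForm _)),
    r + r', Fin.append M M', fun j => ?_, ?_⟩
  · refine Fin.addCases (fun j => ?_) (fun j => ?_) j
    · simpa using hM j
    · simpa using hM' j
  · filter_upwards [hF, hG, eventually_prod_coeffForm_ne_zero hL hM,
      eventually_prod_coeffForm_ne_zero hL hM'] with z h1 h2 h3 h4
    rw [Pi.add_apply, h1, h2, Fin.prod_univ_add]
    simp only [Fin.append_left, Fin.append_right, Pi.add_apply, Pi.mul_apply, Finset.prod_apply]
    rw [div_add_div _ _ h3 h4]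
    ring

theorem IsRatMero.sum (hL : ∀ i, IsRat (L i)) {κ : Type*} (s : Finset κ) {G : κ → DualC → ℂ}
    (hG : ∀ k ∈ s, IsRatMero L (G k)) : IsRatMero L (∑ k ∈ s, G k) :=
  Finset.sum_induction _ (IsRatMero L) (fun _ _ => IsRatMero.add hL) IsRatMero.zero hG

/-- `x` is a rational combination of the vectors of the family `L`. -/
def IsRatComb (L : Fin m → RInf) (x : RInf) : Prop := ∃ a : Fin m → ℚ, x = ∑ i, (a i : ℝ) • L i

theorem isRatMero_expSum {r : ℕ} {v : Fin r → RInf} (hv : ∀ j, IsRatComb L (v j))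
    (hv0 : ∀ j, v j ≠ 0) {B : Finset RInf} (hB : ∀ n ∈ B, IsRatComb L n) :
    IsRatMero L fun z => (∑ n ∈ B, Complex.exp (pair n z)) / ∏ j, (1 - Complex.exp (pair (v j) z)) := by
  choose M hM using hv
  choose! a ha using hB
  -- From `1 - e^w = -w * expQuot w`: the factor `expQuot` is invertible at 0 and goes to the
  -- numerator with the sign, leaving the linear form as the pole.
  refine ⟨(∑ n ∈ B, fun t => Complex.exp (coeffForm (a n) t)) *
    ∏ j : Fin r, ((fun _ : Fin m → ℂ => ((-1 : ℚ) : ℂ)) *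
      (fun t : Fin m → ℂ => expQuot (coeffForm (M j) t))⁻¹), ?_, r, M,
    fun j => hM j ▸ hv0 j, ?_⟩
  · refine (IsRatAnalytic.sum _ fun n _ => IsRatAnalytic.exp _).mul (IsRatAnalytic.prod _ fun j _ => ?_)
    refine (IsRatAnalytic.const _).mul ((IsRatAnalytic.expQuot (M j)).inv ?_)
    simp [coeffForm_zero, expQuot_zero]
  · filter_upwards with z
    simp only [Pi.mul_apply, Finset.sum_apply, Finset.prod_apply, Pi.inv_apply, coeffForm_evalForms,
      ← hM]
    rw [mul_div_assoc, ← Finset.prod_div_distrib, div_eq_mul_inv, ← Finset.prod_inv_distrib]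
    congr 1
    · exact Finset.sum_congr rfl fun n hn => by rw [← ha n hn]
    · refine Finset.prod_congr rfl fun j _ => ?_
      rw [show 1 - Complex.exp (pair (v j) z) = -(pair (v j) z * expQuot (pair (v j) z)) by
        rw [mul_expQuot]; ring]
      push_cast
      rw [inv_neg, mul_inv]
      ring

theorem isRatMero_prod_inv {r : ℕ} {v : Fin r → RInf} (hv : ∀ j, IsRatComb L (v j))
    (hv0 : ∀ j, v j ≠ 0) (q : ℚ) : IsRatMero L fun z => (q : ℂ) / ∏ j, pair (v j) z := by
  choose M hM using hv
  refine ⟨fun _ => (q : ℂ), IsRatAnalytic.const q, r, M, fun j => hM j ▸ hv0 j, ?_⟩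
  filter_upwards with z
  simp only [coeffForm_evalForms, ← hM]

end Mero

/-! ### Exponential sums over the lattice points of an open cone -/

/-- The multiplier of the translation by `u`. -/
def expPair (z : DualC) (u : RInf) : ℂ := Complex.exp (pair u z)

/-- Summation against `e^{⟨x, z⟩}`. -/
def SumValue (z : DualC) (f : RInf → ℂ) (v : ℂ) : Prop := HasSum (fun x => f x * expPair z x) v

theorem expPair_add (z : DualC) (x y : RInf) : expPair z (x + y) = expPair z x * expPair z y := by
  rw [expPair, pair_add, Complex.exp_add]
  rfl

theorem isEquivariant_sumValue (z : DualC) : IsEquivariant (SumValue z) Set.univ (expPair z) where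
  zero := by simp [SumValue]
  eq_zero v h := by
    have h : HasSum (fun x => (0 : RInf → ℂ) x * expPair z x) v := h
    simp only [Pi.zero_apply, zero_mul] at h
    exact h.unique hasSum_zero
  add f g v w hf hg := by
    have := HasSum.add hf hg
    simpa only [SumValue, Pi.add_apply, add_mul] using this
  sub f g v w hf hg := by
    have := HasSum.sub hf hg
    simpa only [SumValue, Pi.sub_apply, sub_mul] using this
  shift u _ f v hf := by
    have h1 : HasSum (fun x => f (x - u) * expPair z (x - u)) v :=
      (Equiv.hasSum_iff (Equiv.subRight u)).2 hf
    refine (h1.mul_left (expPair z u)).congr_fun ?_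
    intro x
    rw [mul_left_comm, ← expPair_add, add_sub_cancel]

/-- In a lattice basis the points have integer coordinates, bounded because the coefficients with
respect to v lie in (0, 1]. -/
theorem finite_halfOpenBox_inter {Λ : Submodule ℤ RInf} {d : ℕ} {b : Fin d → RInf}
    (hb : IsLatticeBasis Λ b) {r : ℕ} {v : Fin r → RInf} (hv : ∀ j, v j ∈ Λ) :
    (halfOpenBox v ∩ (Λ.toAddSubgroup : Set RInf)).Finite := by
  have hrep : ∀ x ∈ Λ, ∃ c : Fin d → ℤ, x = ∑ i, (c i : ℝ) • b i := by
    intro x hx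
    rw [← hb.2] at hx
    obtain ⟨c, hc⟩ := (Submodule.mem_span_range_iff_exists_fun ℤ).1 hx
    exact ⟨c, by simp [← hc, Int.cast_smul_eq_zsmul]⟩
  choose U hU using fun j => hrep _ (hv j)
  refine ((Set.finite_Icc (fun i => -∑ j, |U j i|) (fun i => ∑ j, |U j i|)).image
    (fun c : Fin d → ℤ => ∑ i, (c i : ℝ) • b i)).subset ?_
  rintro x ⟨⟨s, hs, hx⟩, hxΛ⟩
  obtain ⟨c, hc⟩ := hrep x hxΛ
  refine ⟨c, ?_, hc.symm⟩
  have hci : ∀ i, (c i : ℝ) = ∑ j, s j * U j i := by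
    have h0 : ∑ i, ((c i : ℝ) - ∑ j, s j * U j i) • b i = 0 := by
      simp only [sub_smul, Finset.sum_sub_distrib, ← hc, hx]
      rw [sub_eq_zero]
      simp only [Finset.sum_smul]
      rw [Finset.sum_comm]
      refine Finset.sum_congr rfl fun j _ => ?_
      rw [hU j, Finset.smul_sum]
      simp [smul_smul]
    intro i
    exact sub_eq_zero.1 (Fintype.linearIndependent_iff.1 hb.1 _ h0 i)
  have habs : ∀ i, |c i| ≤ ∑ j, |U j i| := by
    intro i
    have : |(c i : ℝ)| ≤ ∑ j, |(U j i : ℝ)| := by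
      rw [hci]
      refine (Finset.abs_sum_le_sum_abs _ _).trans (Finset.sum_le_sum fun j _ => ?_)
      rw [abs_mul, abs_of_pos (hs j).1]
      exact mul_le_of_le_one_left (abs_nonneg _) (hs j).2
    exact_mod_cast this
  exact ⟨fun i => neg_le_of_abs_le (habs i), fun i => le_of_abs_le (habs i)⟩

theorem prod_map_ofFn {r : ℕ} (v : Fin r → RInf) (f : RInf → ℂ) :
    ((List.ofFn v).map f).prod = ∏ j, f (v j) := by
  rw [List.map_ofFn, List.prod_ofFn]
  rfl

namespace LatticeCone

variable (C : LatticeCone)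

/-- The indicator function of the lattice points in the interior. -/
def latticeIndicator : RInf → ℂ := (C.interior ∩ C.lattice).indicator 1

/-- `G` represents the regularized exponential sum of the lattice cone. -/
def IsRegSum (G : DualC → ℂ) : Prop :=
  ∀ᶠ z in poleFilter, RegValue (SumValue z) Set.univ (expPair z) C.latticeIndicator (G z)

/-- Sum the box formulas over an open simplicial decomposition. One G serves for every family L that
rationally spans the lattice: unit vectors give membership in `MQ`, a lattice basis gives locality.
-/
theorem exists_isRegSum : ∃ G : DualC → ℂ, C.IsRegSum G ∧
    ∀ (m : ℕ) (L : Fin m → RInf), (∀ i, IsRat (L i)) → (∀ x ∈ C.lattice, IsRatComb L x) →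
      IsRatMero L G := by
  obtain ⟨κ, _, r, v, hli, hv, hcov, hdisj⟩ := C.exists_simplicial_decomposition
  obtain ⟨d, b, hb, -⟩ := C.isLattice
  have hfin := fun k => finite_halfOpenBox_inter hb (hv k)
  have hv0 : ∀ k j, v k j ≠ 0 := fun k j => (hli k).ne_zero j
  refine ⟨∑ k, fun z => (∑ n ∈ (hfin k).toFinset, Complex.exp (pair n z)) /
    ∏ j, (1 - Complex.exp (pair (v k j) z)), ?_, fun m L hL hC => ?_⟩
  · have hne : ∀ᶠ z in poleFilter, ∀ k j, Complex.exp (pair (v k j) z) ≠ 1 :=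
      eventually_all.2 fun k => eventually_all.2 fun j =>
        eventually_exp_pair_ne_one (C.lattice_rat _ (hv k j)) (hv0 k j)
    filter_upwards [hne] with z hz
    have hind : C.latticeIndicator =
        ∑ k, (openCone (v k) ∩ (C.lattice.toAddSubgroup : Set RInf)).indicator 1 := by
      have h1 : C.interior ∩ (C.lattice : Set RInf) =
          ⋃ k ∈ Finset.univ, openCone (v k) ∩ (C.lattice.toAddSubgroup : Set RInf) := by
        rw [hcov, Set.iUnion_inter]
        simp
      rw [latticeIndicator, h1, Finset.indicator_biUnion]
      · ext x
        simp
      · exact fun k _ k' _ h => (hdisj h).mono Set.inter_subset_left Set.inter_subset_left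
    rw [hind, Finset.sum_apply]
    refine RegValue.sum (isEquivariant_sumValue z) _ fun k _ => ?_
    refine ⟨List.ofFn (v k), ?_, ?_⟩
    · intro u hu
      obtain ⟨j, rfl⟩ := (List.mem_ofFn' _ _).1 hu
      exact ⟨trivial, hz k j⟩
    · rw [diffOps_indicator_openCone (hli k) (hv k), prod_map_ofFn]
      have hprod : ∏ j, (1 - Complex.exp (pair (v k j) z)) ≠ 0 :=
        Finset.prod_ne_zero_iff.2 fun j _ => sub_ne_zero.2 (hz k j).symm
      simp only [expPair]
      rw [mul_div_cancel₀ _ hprod]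
      have : HasSum (fun x => (halfOpenBox (v k) ∩ (C.lattice.toAddSubgroup : Set RInf)).indicator
          (1 : RInf → ℂ) x * expPair z x) (∑ n ∈ (hfin k).toFinset, (halfOpenBox (v k) ∩
            (C.lattice.toAddSubgroup : Set RInf)).indicator (1 : RInf → ℂ) n * expPair z n) := by
        refine hasSum_sum_of_ne_finset_zero fun x hx => ?_
        rw [Set.indicator_of_notMem (by simpa using hx), zero_mul]
      rw [Finset.sum_congr rfl fun n hn => show _ = Complex.exp (pair n z) by
        rw [Set.indicator_of_mem (by simpa using hn), Pi.one_apply, one_mul, expPair]] at this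
      exact this
  · refine IsRatMero.sum hL _ fun k _ => isRatMero_expSum (fun j => hC _ (hv k j)) (hv0 k) ?_
    intro n hn
    exact hC n (((hfin k).mem_toFinset.1 hn).2)

end LatticeCone

/-! ### Identity theorem -/

theorem eqOn_zero_of_real {K : ℕ} {H : (Fin K → ℂ) → ℂ} {w : Fin K → ℝ} {δ : ℝ}
    (hH : AnalyticOnNhd ℂ H (Metric.ball (fun i => (w i : ℂ)) δ))
    (h0 : ∀ y : Fin K → ℝ, (fun i => (y i : ℂ)) ∈ Metric.ball (fun i => (w i : ℂ)) δ →
      H (fun i => (y i : ℂ)) = 0) :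
    ∀ y ∈ Metric.ball (fun i => (w i : ℂ)) δ, H y = 0 := by
  -- Coordinates are freed from the real line one at a time: the first n may be complex. The
  -- one-variable identity theorem applies on a disc, as the real points accumulate at its centre.
  have key : ∀ n : ℕ, ∀ y ∈ Metric.ball (fun i => (w i : ℂ)) δ,
      (∀ i : Fin K, n ≤ i → (y i).im = 0) → H y = 0 := by
    intro n
    induction n with
    | zero =>
      intro y hy him
      have hy' : y = fun i => (((y i).re : ℝ) : ℂ) := by
        ext i
        exact Complex.ext (by simp) (by simp [him i (Nat.zero_le _)])
      rw [hy'] at hy ⊢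
      exact h0 _ hy
    | succ n ih =>
      intro y hy him
      by_cases hn : n < K
      swap
      · exact ih y hy fun i hi => absurd i.2 (by omega)
      set k : Fin K := ⟨n, hn⟩
      have hδ : 0 < δ := Metric.pos_of_mem_ball hy
      have hmem : ∀ ζ ∈ Metric.ball (w k : ℂ) δ,
          Function.update y k ζ ∈ Metric.ball (fun i => (w i : ℂ)) δ := by
        intro ζ hζ
        rw [Metric.mem_ball, dist_pi_lt_iff hδ] at hy ⊢
        intro i
        by_cases hi : i = k
        · subst hi
          simpa using hζ
        · simpa [hi] using hy i
      have hdiff : DifferentiableOn ℂ (fun ζ => H (Function.update y k ζ))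
          (Metric.ball (w k : ℂ) δ) := by
        intro ζ hζ
        have h1 := (hH _ (hmem ζ hζ)).differentiableAt
        exact (h1.comp ζ (hasFDerivAt_update y ζ).differentiableAt).differentiableWithinAt
      have hreal : ∀ᶠ x : ℝ in 𝓝[≠] (w k), H (Function.update y k (x : ℂ)) = 0 := by
        have hball : ∀ᶠ x : ℝ in 𝓝 (w k), (x : ℂ) ∈ Metric.ball (w k : ℂ) δ :=
          Complex.continuous_ofReal.continuousAt.eventually (Metric.ball_mem_nhds _ hδ)
        filter_upwards [hball.filter_mono nhdsWithin_le_nhds] with x hx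
        refine ih _ (hmem _ hx) fun i hi => ?_
        by_cases hik : i = k
        · subst hik
          simp
        · rw [Function.update_of_ne hik]
          refine him i (Nat.lt_of_le_of_ne hi fun h => hik (Fin.ext h.symm))
      have htend : Tendsto (fun x : ℝ => (x : ℂ)) (𝓝[≠] (w k)) (𝓝[≠] (w k : ℂ)) :=
        tendsto_nhdsWithin_of_tendsto_nhds_of_eventually_within _
          (Complex.continuous_ofReal.continuousAt.mono_left nhdsWithin_le_nhds)
          (by filter_upwards [self_mem_nhdsWithin] with x hx using by simpa using hx)
      have hEq := (hdiff.analyticOnNhd Metric.isOpen_ball).eqOn_zero_of_preconnected_of_frequently_eq_zero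
        (convex_ball _ _).isPreconnected (Metric.mem_ball_self hδ) (htend.frequently hreal.frequently)
      have hyk : y k ∈ Metric.ball (w k : ℂ) δ := by
        rw [Metric.mem_ball, dist_pi_lt_iff hδ] at hy
        exact hy k
      simpa using hEq hyk
  intro y hy
  exact key K y hy fun i hi => absurd i.2 (by omega)

/-- Gordan's theorem for a strongly convex cone. -/
theorem LatticeCone.StronglyConvex.exists_dual {D : LatticeCone} (hD : D.StronglyConvex) {n : ℕ}
    {u : Fin n → RInf} (hu : D.cone = closedCone u) :
    ∃ g : RInf →ₗ[ℝ] ℝ, ∀ j, u j ≠ 0 → g (u j) < 0 := by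
  classical
  set W := Submodule.span ℝ (Set.range u)
  have : FiniteDimensional ℝ W := FiniteDimensional.span_of_finite ℝ (Set.finite_range u)
  have : Module.Free ℝ W := Module.Free.of_divisionRing ℝ W
  set e := (Module.finBasis ℝ W).equivFun
  set ι := {j // u j ≠ 0}
  set p : ι → W := fun j => ⟨u j, Submodule.subset_span ⟨j, rfl⟩⟩
  set T : (ι → ℝ) →ₗ[ℝ] (Fin (Module.finrank ℝ W) → ℝ) := e.toLinearMap ∘ₗ Fintype.linearCombination ℝ p
  have hT : ∀ c, T c = e (∑ j, c j • p j) := fun c => by simp [T, Fintype.linearCombination_apply]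
  have hconv : Convex ℝ (T '' stdSimplex ℝ ι) := (convex_stdSimplex ℝ ι).linear_image T
  have hclosed : IsClosed (T '' stdSimplex ℝ ι) :=
    ((isCompact_stdSimplex ℝ ι).image (LinearMap.continuous_on_pi T)).isClosed
  -- The image of the simplex is the convex hull of the nonzero generators. If it contained 0, some
  -- positive multiple of a generator would have its negative in the cone. A hyperplane separating 0
  -- from this compact set gives the functional.
  have h0 : (0 : Fin (Module.finrank ℝ W) → ℝ) ∉ T '' stdSimplex ℝ ι := by
    rintro ⟨c, ⟨hc, hc1⟩, h⟩
    rw [hT, map_eq_zero_iff _ e.injective] at h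
    have h : ∑ j : ι, c j • u j = 0 := by simpa [p] using congrArg W.subtype h
    obtain ⟨j, hj⟩ : ∃ j, c j ≠ 0 := by
      by_contra! hall
      simp [hall] at hc1
    have hmem : ∀ i : ι, c i • u i ∈ D.cone :=
      fun i => LatticeCone.smul_mem_cone (hu ▸ mem_closedCone i.1) (hc i)
    have hsum : ∑ i ∈ Finset.univ.erase j, c i • u i ∈ D.cone :=
      Finset.sum_induction _ (· ∈ D.cone) (fun _ _ => LatticeCone.add_mem_cone)
        (by simpa using LatticeCone.smul_mem_cone (hmem j) le_rfl) fun i _ => hmem i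
    rw [← Finset.add_sum_erase _ _ (Finset.mem_univ j), add_comm] at h
    rw [eq_neg_of_add_eq_zero_left h] at hsum
    exact (smul_ne_zero hj j.2) (hD _ (hmem j) hsum)
  obtain ⟨f, a, ha, hf⟩ := geometric_hahn_banach_point_closed hconv hclosed h0
  obtain ⟨g, hg⟩ := LinearMap.exists_extend ((f : _ →ₗ[ℝ] ℝ) ∘ₗ e.toLinearMap)
  refine ⟨-g, fun j hj => ?_⟩
  have h1 := hf _ ⟨Pi.single ⟨j, hj⟩ 1, single_mem_stdSimplex ℝ _, rfl⟩
  have h2 : g (u j) = f (e (p ⟨j, hj⟩)) := LinearMap.congr_fun hg (p ⟨j, hj⟩)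
  rw [hT, show ∑ i, (Pi.single ⟨j, hj⟩ 1 : ι → ℝ) i • p i = p ⟨j, hj⟩ by
    rw [Finset.sum_eq_single ⟨j, hj⟩ (fun i _ hi => by rw [Pi.single_eq_of_ne hi, zero_smul])
      (fun h => absurd (Finset.mem_univ _) h), Pi.single_eq_same, one_smul], ← h2] at h1
  rw [map_zero] at ha
  simpa using ha.trans h1

theorem pair_ofReal_eq (g : RInf →ₗ[ℝ] ℝ) (x : RInf) :
    pair x (fun i => (g (unitVec i) : ℂ)) = g x := by
  have : g x = x.sum fun i a => a * g (unitVec i) := by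
    conv_lhs => rw [← Finsupp.sum_single x]
    rw [Finsupp.sum, map_sum, Finsupp.sum]
    refine Finset.sum_congr rfl fun i _ => ?_
    rw [← smul_eq_mul, ← map_smul, unitVec, Finsupp.smul_single, smul_eq_mul, mul_one]
  rw [this, pair, Finsupp.sum, Finsupp.sum]
  push_cast
  rfl

theorem mem_negDual {D : LatticeCone} {n : ℕ} {u : Fin n → RInf} (hu : D.cone = closedCone u)
    {z : DualC} (hz : ∀ i, (z i).im = 0) (h : ∀ j, u j ≠ 0 → (pair (u j) z).re < 0) :
    z ∈ D.negDual := by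
  refine ⟨hz, fun x hx hx0 => ?_⟩
  rw [hu] at hx
  obtain ⟨c, hc, rfl⟩ := hx
  rw [pair_sum_smul, Complex.re_sum]
  obtain ⟨j, -, hj⟩ := Finset.exists_ne_zero_of_sum_ne_zero hx0
  have hle : ∀ i ∈ Finset.univ, ((c i : ℂ) * pair (u i) z).re ≤ 0 := by
    intro i _
    rw [Complex.re_ofReal_mul]
    by_cases hi : u i = 0
    · simp [hi, pair]
    · exact mul_nonpos_of_nonneg_of_nonpos (hc i) (h i hi).le
  refine Finset.sum_neg' hle ⟨j, Finset.mem_univ j, ?_⟩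
  rw [Complex.re_ofReal_mul]
  exact mul_neg_of_pos_of_neg ((hc j).lt_of_ne fun h => hj (by simp [← h]))
    (h j fun h => hj (by simp [h]))

/-- A functional negative on the generators, scaled to be small, is a point of the dual cone near 0.
Around it the first K coordinates can vary over an open set of real points within the dual cone,
which suffices for the identity theorem. -/
theorem eventually_eq_zero_of_negDual {D : LatticeCone} (hD : D.StronglyConvex) {K : ℕ}
    {Φ : (Fin K → ℂ) → ℂ} (hΦ : AnalyticAt ℂ Φ 0)
    (h : ∀ᶠ z in 𝓝 0 ⊓ 𝓟 D.negDual, Φ (fun i => z i) = 0) : ∀ᶠ y in 𝓝 0, Φ y = 0 := by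
  obtain ⟨n, u, -, hu⟩ := D.exists_generators
  obtain ⟨g, hg⟩ := hD.exists_dual hu
  obtain ⟨U, hU0, hU⟩ : ∃ U ∈ 𝓝 (0 : DualC), ∀ z ∈ U, z ∈ D.negDual → Φ (fun i => z i) = 0 :=
    ⟨_, eventually_inf_principal.1 h, fun z hz hz' => hz hz'⟩
  obtain ⟨ρ, hρ, hball⟩ := Metric.eventually_nhds_iff_ball.1 hΦ.eventually_analyticAt
  -- The coordinates from K on are frozen at those of the scaled functional, not at 0, because the
  -- pairing with the generators may involve them.
  set E : (Fin K → ℝ) → ℝ → DualC := fun y ε i =>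
    if hi : i < K then (y ⟨i, hi⟩ : ℂ) else ((ε * g (unitVec i) : ℝ) : ℂ)
  have hE : ∀ ε, Continuous fun y => E y ε := by
    intro ε
    refine continuous_pi fun i => ?_
    by_cases hi : i < K
    · simp only [E, hi, dite_true]
      fun_prop
    · simp only [E, hi, dite_false]
      fun_prop
  have hEre : ∀ y ε i, (E y ε i).im = 0 := by
    intro y ε i
    by_cases hi : i < K <;> simp [E, hi]
  set w : ℝ → Fin K → ℝ := fun ε i => ε * g (unitVec i)
  have hEw : ∀ ε, E (w ε) ε = fun i => ((ε * g (unitVec i) : ℝ) : ℂ) := by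
    intro ε
    ext i
    by_cases hi : i < K <;> simp [E, hi, w]
  obtain ⟨ε, ⟨hεU, hερ⟩, hε⟩ : ∃ ε : ℝ, (E (w ε) ε ∈ interior U ∧
      (fun i => (w ε i : ℂ)) ∈ Metric.ball (0 : Fin K → ℂ) ρ) ∧ 0 < ε := by
    have h1 : Tendsto (fun ε => E (w ε) ε) (𝓝[>] 0) (𝓝 0) := by
      have : Continuous fun ε => E (w ε) ε := by
        simp only [hEw]
        fun_prop
      have h2 := (this.tendsto 0).mono_left (nhdsWithin_le_nhds (s := Set.Ioi 0))
      convert h2 using 2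
      rw [hEw]
      ext i
      simp
    have h2 : Tendsto (fun ε => fun i => (w ε i : ℂ)) (𝓝[>] 0) (𝓝 (0 : Fin K → ℂ)) := by
      have : Continuous fun ε => fun i => (w ε i : ℂ) := by
        fun_prop
      have h2 := (this.tendsto 0).mono_left (nhdsWithin_le_nhds (s := Set.Ioi 0))
      convert h2 using 2
      ext i
      simp [w]
    exact (((h1.eventually (interior_mem_nhds.2 hU0)).and
      (h2.eventually (Metric.ball_mem_nhds 0 hρ))).and self_mem_nhdsWithin).exists
  have hgood : ∀ᶠ y in 𝓝 (w ε), E y ε ∈ U ∧ ∀ j, u j ≠ 0 → (pair (u j) (E y ε)).re < 0 := by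
    refine Filter.Eventually.and ?_ (eventually_all.2 fun j => ?_)
    · have := (hE ε).continuousAt.eventually (isOpen_interior.mem_nhds hεU)
      filter_upwards [this] with y hy using interior_subset hy
    · by_cases hj : u j = 0
      · simp [hj]
      · have hc : Continuous fun y => (pair (u j) (E y ε)).re :=
          Complex.continuous_re.comp ((continuous_pair _).comp (hE ε))
        have h1 : (pair (u j) (E (w ε) ε)).re < 0 := by
          have h2 := pair_ofReal_eq (ε • g) (u j)
          rw [hEw]
          simp only [LinearMap.smul_apply, smul_eq_mul] at h2
          rw [h2, Complex.ofReal_re]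
          exact mul_neg_of_pos_of_neg hε (hg j hj)
        filter_upwards [hc.continuousAt.eventually (gt_mem_nhds h1)] with y hy _ using hy
  obtain ⟨δ₁, hδ₁, hgood⟩ := Metric.eventually_nhds_iff_ball.1 hgood
  obtain ⟨δ₂, hδ₂, hsub⟩ := Metric.isOpen_iff.1 Metric.isOpen_ball _ hερ
  have hzero : ∀ y ∈ Metric.ball (fun i => (w ε i : ℂ)) (min δ₁ δ₂), Φ y = 0 := by
    refine eqOn_zero_of_real (fun y hy => hball y (hsub ?_)) fun y hy => ?_
    · exact Metric.ball_subset_ball (min_le_right _ _) hy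
    · have hy' : y ∈ Metric.ball (w ε) δ₁ := by
        have h1 := Metric.ball_subset_ball (min_le_left _ _) hy
        rw [Metric.mem_ball, dist_pi_lt_iff hδ₁] at h1 ⊢
        intro i
        simpa [Complex.dist_eq, ← Complex.ofReal_sub, Real.dist_eq] using h1 i
      obtain ⟨h1, h2⟩ := hgood y hy'
      have h3 := hU _ h1 (mem_negDual hu (hEre y ε) h2)
      simpa [E] using h3
  have hEq := AnalyticOnNhd.eqOn_zero_of_preconnected_of_eventuallyEq_zero (f := Φ)
    (U := Metric.ball 0 ρ) (fun y hy => hball y hy) (convex_ball _ _).isPreconnected hερ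
    (by filter_upwards [Metric.ball_mem_nhds _ (lt_min hδ₁ hδ₂)] with y hy using hzero y hy)
  filter_upwards [Metric.ball_mem_nhds _ hρ] with y hy using hEq hy

/-- A member of an infimum of principal filters uses finitely many of them, so only finitely many
hyperplanes are removed. -/
theorem exists_finset_of_eventually_poleFilter {p : DualC → Prop} (h : ∀ᶠ z in poleFilter, p z) :
    ∃ T : Finset RInf, (∀ u ∈ T, IsRat u ∧ u ≠ 0) ∧
      ∀ᶠ z in 𝓝 0, (∀ u ∈ T, pair u z ≠ 0) → p z := by
  classical
  obtain ⟨s, hs, t, ht, hst⟩ := Filter.mem_inf_iff_superset.1 h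
  rw [iInf_subtype', Filter.mem_iInf_finite] at ht
  obtain ⟨T, hT⟩ := ht
  rw [iInf_principal_finset, mem_principal] at hT
  refine ⟨T.image Subtype.val, fun u hu => ?_, ?_⟩
  · obtain ⟨u, -, rfl⟩ := Finset.mem_image.1 hu
    exact u.2
  · filter_upwards [hs] with z hz hzT
    refine hst ⟨hz, hT ?_⟩
    simp only [Set.mem_iInter]
    exact fun u hu => hzT u.1 (Finset.mem_image_of_mem _ hu)

/-- The extension by zero of the first `K` coordinates. -/
def extendZero {K : ℕ} (y : Fin K → ℂ) : DualC := fun i => if hi : i < K then y ⟨i, hi⟩ else 0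

theorem analyticAt_extendZero {K : ℕ} (i : ℕ) (y : Fin K → ℂ) :
    AnalyticAt ℂ (fun y : Fin K → ℂ => extendZero y i) y := by
  by_cases hi : i < K
  · simp only [extendZero, hi, dite_true]
    exact (ContinuousLinearMap.proj (R := ℂ) (φ := fun _ : Fin K => ℂ) ⟨i, hi⟩).analyticAt y
  · simp only [extendZero, hi, dite_false]
    exact analyticAt_const

theorem analyticAt_pair_extendZero {K : ℕ} (u : RInf) (y : Fin K → ℂ) :
    AnalyticAt ℂ (fun y : Fin K → ℂ => pair u (extendZero y)) y := by
  simp only [pair, Finsupp.sum]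
  exact Finset.analyticAt_fun_sum _ fun i _ => analyticAt_const.mul (analyticAt_extendZero i y)

theorem pair_extendZero {K : ℕ} {u : RInf} (hu : ∀ i ∈ u.support, i < K) (z : DualC) :
    pair u (extendZero fun i : Fin K => z i) = pair u z := by
  simp only [pair, Finsupp.sum]
  exact Finset.sum_congr rfl fun i hi => by simp [extendZero, hu i hi]

theorem extendZero_zero {K : ℕ} : extendZero (0 : Fin K → ℂ) = 0 := by
  ext i
  simp [extendZero]

theorem isRat_unitVec (i : ℕ) : IsRat (unitVec i) := by
  intro j
  refine ⟨if i = j then 1 else 0, ?_⟩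
  simp only [unitVec, Finsupp.single_apply]
  split_ifs <;> simp

theorem pair_unitVec (i : ℕ) (z : DualC) : pair (unitVec i) z = z i := by
  simp [pair, unitVec]

/-- Two meromorphic germs that agree on the dual cone of a strongly convex cone are equal. -/
theorem eq_of_eventually_negDual {D : LatticeCone} (hD : D.StronglyConvex) {f f' : PoleGerm}
    (hf : f ∈ MQ) (hf' : f' ∈ MQ) {F F' : DualC → ℂ} (hF : f = (F : PoleGerm))
    (hF' : f' = (F' : PoleGerm)) (h : ∀ᶠ z in poleFilter ⊓ 𝓟 D.negDual, F z = F' z) : f = f' := by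
  obtain ⟨k, p, hp, r, M, hM, hfp⟩ := hf
  obtain ⟨k', p', hp', r', M', hM', hfp'⟩ := hf'
  set N : DualC → ℂ := fun z => p (evalForms (fun i : Fin k => unitVec i) z)
  set N' : DualC → ℂ := fun z => p' (evalForms (fun i : Fin k' => unitVec i) z)
  set u : Fin r → RInf := fun j => ∑ i, (M j i : ℝ) • unitVec i
  set u' : Fin r' → RInf := fun j => ∑ i, (M' j i : ℝ) • unitVec i
  have hu : ∀ z, ∏ j, ∑ i, (M j i : ℂ) * pair (unitVec i) z = ∏ j, pair (u j) z :=
    fun z => Finset.prod_congr rfl fun j _ => by simp [u, pair_sum_smul]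
  have hu' : ∀ z, ∏ j, ∑ i, (M' j i : ℂ) * pair (unitVec i) z = ∏ j, pair (u' j) z :=
    fun z => Finset.prod_congr rfl fun j _ => by simp [u', pair_sum_smul]
  have hfN : ∀ᶠ z in poleFilter, F z = N z / ∏ j, pair (u j) z := by
    filter_upwards [Germ.coe_eq.1 (hF.symm.trans hfp)] with z hz
    rw [hz, hu]
    rfl
  have hfN' : ∀ᶠ z in poleFilter, F' z = N' z / ∏ j, pair (u' j) z := by
    filter_upwards [Germ.coe_eq.1 (hF'.symm.trans hfp')] with z hz
    rw [hz, hu']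
    rfl
  have hne : ∀ᶠ z in poleFilter, ∏ j, pair (u j) z ≠ 0 := by
    simp only [Finset.prod_ne_zero_iff, Finset.mem_univ, true_imp_iff]
    exact eventually_all.2 fun j =>
      eventually_pair_ne_zero (isRat_sum_smul (fun i => isRat_unitVec i) _) (hM j)
  have hne' : ∀ᶠ z in poleFilter, ∏ j, pair (u' j) z ≠ 0 := by
    simp only [Finset.prod_ne_zero_iff, Finset.mem_univ, true_imp_iff]
    exact eventually_all.2 fun j =>
      eventually_pair_ne_zero (isRat_sum_smul (fun i => isRat_unitVec i) _) (hM' j)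
  have hcross : ∀ᶠ z in poleFilter, z ∈ D.negDual →
      N z * ∏ j, pair (u' j) z - N' z * ∏ j, pair (u j) z = 0 := by
    filter_upwards [eventually_inf_principal.1 h, hfN, hfN', hne, hne'] with z h1 h2 h3 h4 h5 hz
    have := h1 hz
    rw [h2, h3, div_eq_div_iff h4 h5] at this
    rw [this, sub_self]
  obtain ⟨T, hT, hcross⟩ := exists_finset_of_eventually_poleFilter hcross
  -- Cross-multiplication makes the difference holomorphic. The last product vanishes on the
  -- excluded hyperplanes, so H is zero on the whole dual cone near 0, including where the
  -- hypothesis says nothing.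
  set H : DualC → ℂ := fun z =>
    (N z * ∏ j, pair (u' j) z - N' z * ∏ j, pair (u j) z) * ∏ w ∈ T, pair w z
  obtain ⟨K, hK⟩ : ∃ K : ℕ, k ≤ K ∧ k' ≤ K ∧ (∀ j, ∀ i ∈ (u j).support, i < K) ∧
      (∀ j, ∀ i ∈ (u' j).support, i < K) ∧ ∀ w ∈ T, ∀ i ∈ w.support, i < K := by
    have hbd : ∀ S : Finset ℕ, ∀ᶠ K in atTop, ∀ i ∈ S, i < K := fun S =>
      (Finset.eventually_all S).2 fun i _ => eventually_gt_atTop i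
    exact ((eventually_ge_atTop k).and ((eventually_ge_atTop k').and ((eventually_all.2 fun j =>
      hbd _).and ((eventually_all.2 fun j => hbd _).and ((Finset.eventually_all T).2 fun w _ =>
        hbd _))))).exists
  obtain ⟨hk, hk', hKu, hKu', hKT⟩ := hK
  have heval : ∀ (k : ℕ) (_ : k ≤ K) (z : DualC),
      evalForms (fun i : Fin k => unitVec i) (extendZero fun i : Fin K => z i) =
        evalForms (fun i : Fin k => unitVec i) z := by
    intro k hk z
    ext i
    simp [evalForms, pair_unitVec, extendZero, i.2.trans_le hk]
  have hanalytic : ∀ {k : ℕ} {p : (Fin k → ℂ) → ℂ}, AnalyticAt ℂ p 0 → AnalyticAt ℂ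
      (fun y : Fin K → ℂ => p (evalForms (fun i : Fin k => unitVec i) (extendZero y))) 0 := by
    intro k p hp
    have h0 : evalForms (fun i : Fin k => unitVec i) (extendZero (0 : Fin K → ℂ)) = 0 := by
      funext i
      simp [evalForms, extendZero_zero, pair_at_zero]
    have hev : AnalyticAt ℂ
        (fun y : Fin K → ℂ => evalForms (fun i : Fin k => unitVec i) (extendZero y)) 0 :=
      AnalyticAt.pi fun i => analyticAt_pair_extendZero _ _
    have hp0 : AnalyticAt ℂ p
        (evalForms (fun i : Fin k => unitVec i) (extendZero (0 : Fin K → ℂ))) := by rwa [h0]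
    exact hp0.comp (f := fun y : Fin K → ℂ =>
      evalForms (fun i : Fin k => unitVec i) (extendZero y)) hev
  have hH : AnalyticAt ℂ (fun y : Fin K → ℂ => H (extendZero y)) 0 := by
    refine AnalyticAt.mul (AnalyticAt.sub (AnalyticAt.mul (hanalytic hp.1) ?_)
      (AnalyticAt.mul (hanalytic hp'.1) ?_)) ?_
    all_goals exact Finset.analyticAt_fun_prod _ fun j _ => analyticAt_pair_extendZero _ _
  have hHz : ∀ z, H (extendZero fun i : Fin K => z i) = H z := by
    intro z
    simp only [H, N, N', heval k hk, heval k' hk', pair_extendZero (hKu _), pair_extendZero (hKu' _)]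
    congr 1
    exact Finset.prod_congr rfl fun w hw => pair_extendZero (hKT w hw) z
  have hzero := eventually_eq_zero_of_negDual hD hH (by
    rw [eventually_inf_principal]
    filter_upwards [hcross] with z hz hzD
    rw [hHz]
    by_cases hw : ∀ w ∈ T, pair w z ≠ 0
    · simp only [H]
      rw [hz hw hzD, zero_mul]
    · push Not at hw
      obtain ⟨w, hw, hwz⟩ := hw
      simp only [H]
      rw [Finset.prod_eq_zero hw hwz, mul_zero])
  have htend : Tendsto (fun z : DualC => fun i : Fin K => z i) (𝓝 0) (𝓝 0) :=
    Continuous.tendsto (by fun_prop) (0 : DualC)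
  have hHzero : ∀ᶠ z in poleFilter, H z = 0 := by
    filter_upwards [poleFilter_le_nhds (htend.eventually hzero)] with z hz
    rwa [← hHz]
  rw [hF, hF']
  refine Germ.coe_eq.2 ?_
  have hTne : ∀ᶠ z in poleFilter, ∏ w ∈ T, pair w z ≠ 0 := by
    simp only [Finset.prod_ne_zero_iff]
    exact (Finset.eventually_all T).2 fun w hw => eventually_pair_ne_zero (hT w hw).1 (hT w hw).2
  filter_upwards [hHzero, hfN, hfN', hne, hne', hTne] with z h1 h2 h3 h4 h5 h6
  rw [h2, h3, div_eq_div_iff h4 h5]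
  exact sub_eq_zero.1 ((mul_eq_zero.1 h1).resolve_right h6)

/-- The vectors of a lattice cone are rational combinations of finitely many unit vectors. -/
theorem LatticeCone.exists_isRatComb_unitVec (C : LatticeCone) :
    ∃ k : ℕ, ∀ x ∈ C.lattice, IsRatComb (fun i : Fin k => unitVec i) x := by
  obtain ⟨d, b, hb, -⟩ := C.isLattice
  obtain ⟨k, hk⟩ : ∃ k : ℕ, ∀ j, ∀ i ∈ (b j).support, i < k :=
    (eventually_all.2 fun j => (Finset.eventually_all (b j).support).2 fun i _ =>
      eventually_gt_atTop i).exists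
  refine ⟨k, fun x hx => ?_⟩
  choose q hq using C.lattice_rat x hx
  refine ⟨fun i => q i, ?_⟩
  rw [← hb.2] at hx
  obtain ⟨c, hc⟩ := (Submodule.mem_span_range_iff_exists_fun ℤ).1 hx
  have hsupp : ∀ i, k ≤ i → x i = 0 := by
    intro i hi
    rw [← hc, Finsupp.finsetSum_apply]
    refine Finset.sum_eq_zero fun j _ => ?_
    have : b j i = 0 := Finsupp.notMem_support_iff.1 fun h => absurd (hk j i h) (by omega)
    simp [this]
  ext i
  simp only [Finsupp.finsetSum_apply, Finsupp.smul_apply, unitVec, Finsupp.single_apply, smul_eq_mul,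
    mul_ite, mul_one, mul_zero, ← hq]
  by_cases hi : i < k
  · rw [Finset.sum_eq_single ⟨i, hi⟩] <;> simp +contextual [Fin.ext_iff]
  · rw [hsupp i (by omega), Finset.sum_eq_zero fun j _ => if_neg (by omega)]

/-! ### Exponential integrals over open cones -/

open MeasureTheory

section Integral

variable {d : ℕ}

theorem integral_comp_linearEquiv (T : (Fin d → ℝ) ≃ₗ[ℝ] (Fin d → ℝ)) (g : (Fin d → ℝ) → ℂ) :
    ∫ t, g t = ((|LinearMap.det (T : (Fin d → ℝ) →ₗ[ℝ] (Fin d → ℝ))| : ℝ) : ℂ) * ∫ s, g (T s) := by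
  have hdet : LinearMap.det (T : (Fin d → ℝ) →ₗ[ℝ] (Fin d → ℝ)) ≠ 0 := T.isUnit_det'.ne_zero
  have hmap := Measure.map_linearMap_addHaar_eq_smul_addHaar (volume : Measure (Fin d → ℝ)) hdet
  have hemb : MeasurableEmbedding T :=
    T.toContinuousLinearEquiv.toHomeomorph.measurableEmbedding
  have h := hemb.integral_map (μ := volume) g
  rw [← h]
  change _ = _ * ∫ y, g y ∂(Measure.map (T : (Fin d → ℝ) →ₗ[ℝ] (Fin d → ℝ)) volume)
  rw [hmap, integral_smul_measure, ENNReal.toReal_ofReal (abs_nonneg _), abs_inv,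
    Complex.real_smul, ← mul_assoc, ← Complex.ofReal_mul, mul_inv_cancel₀ (abs_ne_zero.2 hdet)]
  simp

theorem integrable_comp_linearEquiv_iff (T : (Fin d → ℝ) ≃ₗ[ℝ] (Fin d → ℝ)) (g : (Fin d → ℝ) → ℂ) :
    Integrable (fun s => g (T s)) ↔ Integrable g := by
  have hdet : LinearMap.det (T : (Fin d → ℝ) →ₗ[ℝ] (Fin d → ℝ)) ≠ 0 := T.isUnit_det'.ne_zero
  have hmap := Measure.map_linearMap_addHaar_eq_smul_addHaar (volume : Measure (Fin d → ℝ)) hdet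
  have hemb : MeasurableEmbedding T :=
    T.toContinuousLinearEquiv.toHomeomorph.measurableEmbedding
  have h := hemb.integrable_map_iff (μ := volume) (g := g)
  change Integrable g (Measure.map (T : (Fin d → ℝ) →ₗ[ℝ] (Fin d → ℝ)) volume) ↔ _ at h
  rw [hmap, integrable_smul_measure (by simpa using hdet) ENNReal.ofReal_ne_top] at h
  exact h.symm

/-- Integration against `e^{⟨x, z⟩}` in the coordinates given by `b`. -/
def IntValue (b : Fin d → RInf) (z : DualC) (f : RInf → ℂ) (v : ℂ) : Prop :=
  Integrable (fun t : Fin d → ℝ => f (∑ i, t i • b i) * expPair z (∑ i, t i • b i)) ∧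
    ∫ t : Fin d → ℝ, f (∑ i, t i • b i) * expPair z (∑ i, t i • b i) = v

theorem isEquivariant_intValue (b : Fin d → RInf) (z : DualC) :
    IsEquivariant (IntValue b z) (Submodule.span ℝ (Set.range b)) (expPair z) where
  zero := by simp [IntValue]
  eq_zero v h := by simpa [IntValue, eq_comm] using h
  add f g v w hf hg := by
    simp only [IntValue, Pi.add_apply, add_mul]
    exact ⟨hf.1.add hg.1, by rw [integral_add hf.1 hg.1, hf.2, hg.2]⟩
  sub f g v w hf hg := by
    simp only [IntValue, Pi.sub_apply, sub_mul]
    exact ⟨hf.1.sub hg.1, by rw [integral_sub hf.1 hg.1, hf.2, hg.2]⟩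
  shift u hu f v hf := by
    obtain ⟨s, rfl⟩ := (Submodule.mem_span_range_iff_exists_fun ℝ).1 hu
    have h : (fun t : Fin d → ℝ => f (∑ i, t i • b i - ∑ i, s i • b i) *
        expPair z (∑ i, t i • b i)) = fun t => expPair z (∑ i, s i • b i) *
          (fun t => f (∑ i, t i • b i) * expPair z (∑ i, t i • b i)) (t - s) := by
      ext t
      simp only [Pi.sub_apply, sub_smul, Finset.sum_sub_distrib]
      rw [mul_left_comm, ← expPair_add, add_sub_cancel]
    simp only [IntValue]
    rw [h]
    refine ⟨(hf.1.comp_sub_right s).const_mul _, ?_⟩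
    rw [integral_const_mul, integral_sub_right_eq_self
      (fun t : Fin d → ℝ => f (∑ i, t i • b i) * expPair z (∑ i, t i • b i)) s, hf.2]

theorem ae_notMem_of_subset {b : Fin d → RInf} {W : Submodule ℝ RInf} {i : Fin d} (hi : b i ∉ W)
    {X : Set RInf} (hX : X ⊆ W) : ∀ᵐ t : Fin d → ℝ, ∑ i, t i • b i ∉ X := by
  set W' : Submodule ℝ (Fin d → ℝ) := W.comap (Fintype.linearCombination ℝ b)
  have hW' : W' ≠ ⊤ := by
    intro h
    have : Pi.single i 1 ∈ W' := h ▸ Submodule.mem_top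
    apply hi
    simpa [W', Fintype.linearCombination_apply, Pi.single_apply, ite_smul] using this
  have h0 := Measure.addHaar_submodule volume W' hW'
  refine measure_mono_null (fun t ht => ?_) h0
  have ht : ∑ i, t i • b i ∈ X := not_not.1 ht
  change Fintype.linearCombination ℝ b t ∈ W
  rw [Fintype.linearCombination_apply]
  exact hX ht

/-- A proper subspace is a null set in the coordinates, so pieces of lower dimension do not
contribute. -/
theorem intValue_zero_of_subset {b : Fin d → RInf} {W : Submodule ℝ RInf} {i : Fin d} (hi : b i ∉ W)
    {X : Set RInf} (hX : X ⊆ W) (z : DualC) : IntValue b z (X.indicator 1) 0 := by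
  have h : (fun t : Fin d → ℝ => X.indicator (1 : RInf → ℂ) (∑ i, t i • b i) *
      expPair z (∑ i, t i • b i)) =ᵐ[volume] 0 := by
    filter_upwards [ae_notMem_of_subset hi hX] with t ht
    simp [ht]
  exact ⟨(integrable_zero _ _ _).congr h.symm, by rw [integral_congr_ae h]; simp⟩

/-- The change of coordinates from a linearly independent family of lattice vectors to a lattice
basis; its determinant is an integer. -/
theorem exists_coordChange {Λ : Submodule ℤ RInf} {b : Fin d → RInf} (hb : IsLatticeBasis Λ b)
    {v : Fin d → RInf} (hli : LinearIndependent ℝ v) (hv : ∀ j, v j ∈ Λ) :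
    ∃ T : (Fin d → ℝ) ≃ₗ[ℝ] (Fin d → ℝ), (∀ s, ∑ i, T s i • b i = ∑ j, s j • v j) ∧
      ∃ q : ℤ, LinearMap.det (T : (Fin d → ℝ) →ₗ[ℝ] (Fin d → ℝ)) = q := by
  have hrep : ∀ j, ∃ c : Fin d → ℤ, ∑ i, c i • b i = v j := fun j =>
    (Submodule.mem_span_range_iff_exists_fun ℤ).1 (hb.2.symm ▸ hv j)
  choose U hU using hrep
  set A : Matrix (Fin d) (Fin d) ℤ := Matrix.of fun i j => U j i
  set T₀ : (Fin d → ℝ) →ₗ[ℝ] (Fin d → ℝ) := Matrix.toLin' (A.map (Int.castRingHom ℝ))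
  have hT₀ : ∀ s, ∑ i, T₀ s i • b i = ∑ j, s j • v j := by
    intro s
    simp only [T₀, Matrix.toLin'_apply, Matrix.mulVec, dotProduct, Finset.sum_smul]
    rw [Finset.sum_comm]
    refine Finset.sum_congr rfl fun j _ => ?_
    rw [← hU j, Finset.smul_sum]
    refine Finset.sum_congr rfl fun i _ => ?_
    rw [← Int.cast_smul_eq_zsmul ℝ, smul_smul]
    simp [A, mul_comm]
  have hinj : Function.Injective T₀ := by
    refine (injective_iff_map_eq_zero T₀).2 fun s hs => ?_
    have := hT₀ s
    rw [hs] at this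
    funext j
    exact Fintype.linearIndependent_iff.1 hli s (by simp [← this]) j
  refine ⟨LinearEquiv.ofInjectiveEndo T₀ hinj, hT₀, A.det, ?_⟩
  have : ((LinearEquiv.ofInjectiveEndo T₀ hinj : (Fin d → ℝ) ≃ₗ[ℝ] (Fin d → ℝ)) :
      (Fin d → ℝ) →ₗ[ℝ] (Fin d → ℝ)) = T₀ := rfl
  rw [this, LinearMap.det_toLin', ← RingHom.mapMatrix_apply, ← RingHom.map_det]
  rfl

/-- In the coordinates of v the integrand is a product of functions of one variable. The interval I
is (0, 1] for the box and (0, ∞) for the open cone. -/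
theorem indicator_mul_expPair_eq_prod {v : Fin d → RInf} (hli : LinearIndependent ℝ v) (z : DualC)
    (I : Set ℝ) (s : Fin d → ℝ) :
    {x : RInf | ∃ c : Fin d → ℝ, (∀ j, c j ∈ I) ∧ x = ∑ j, c j • v j}.indicator (1 : RInf → ℂ)
      (∑ j, s j • v j) * expPair z (∑ j, s j • v j) =
      ∏ j, I.indicator (fun a : ℝ => Complex.exp (pair (v j) z * a)) (s j) := by
  have hmem : (∑ j, s j • v j) ∈ {x : RInf | ∃ c : Fin d → ℝ, (∀ j, c j ∈ I) ∧ x = ∑ j, c j • v j} ↔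
      ∀ j, s j ∈ I := by
    constructor
    · rintro ⟨c, hc, h⟩ j
      have := Fintype.linearIndependent_iff.1 hli (s - c) (by simp [sub_smul, h]) j
      rw [sub_eq_zero.1 this]
      exact hc j
    · exact fun h => ⟨s, h, rfl⟩
  by_cases h : ∀ j, s j ∈ I
  · rw [Set.indicator_of_mem (hmem.2 h), Pi.one_apply, one_mul, expPair, pair_sum_smul,
      Complex.exp_sum]
    refine Finset.prod_congr rfl fun j _ => ?_
    rw [Set.indicator_of_mem (h j), mul_comm]
  · rw [Set.indicator_of_notMem (fun h' => h (hmem.1 h')), zero_mul]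
    push Not at h
    obtain ⟨j, hj⟩ := h
    exact (Finset.prod_eq_zero (Finset.mem_univ j) (Set.indicator_of_notMem hj _)).symm

theorem intValue_halfOpenBox {b v : Fin d → RInf} (hli : LinearIndependent ℝ v)
    {T : (Fin d → ℝ) ≃ₗ[ℝ] (Fin d → ℝ)} (hT : ∀ s, ∑ i, T s i • b i = ∑ j, s j • v j) {z : DualC}
    (hz : ∀ j, pair (v j) z ≠ 0) :
    IntValue b z ((halfOpenBox v).indicator 1)
      (((|LinearMap.det (T : (Fin d → ℝ) →ₗ[ℝ] (Fin d → ℝ))| : ℝ) : ℂ) *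
        ∏ j, ((Complex.exp (pair (v j) z) - 1) / pair (v j) z)) := by
  have hprod := indicator_mul_expPair_eq_prod hli z (Set.Ioc 0 1)
  rw [IntValue, ← integrable_comp_linearEquiv_iff T, integral_comp_linearEquiv T]
  simp only [hT]
  change Integrable (fun s : Fin d → ℝ => {x : RInf | ∃ c : Fin d → ℝ,
    (∀ j, c j ∈ Set.Ioc 0 1) ∧ x = ∑ j, c j • v j}.indicator (1 : RInf → ℂ) (∑ j, s j • v j) *
      expPair z (∑ j, s j • v j)) ∧ _ * (∫ s : Fin d → ℝ, {x : RInf | ∃ c : Fin d → ℝ,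
    (∀ j, c j ∈ Set.Ioc 0 1) ∧ x = ∑ j, c j • v j}.indicator (1 : RInf → ℂ) (∑ j, s j • v j) *
      expPair z (∑ j, s j • v j)) = _
  simp only [hprod]
  constructor
  · refine Integrable.fintype_prod fun j => ?_
    rw [integrable_indicator_iff measurableSet_Ioc]
    exact (Continuous.integrableOn_Icc (by fun_prop)).mono_set Set.Ioc_subset_Icc_self
  · rw [integral_fintype_prod_volume_eq_prod (fun j => (Set.Ioc (0 : ℝ) 1).indicator
      fun a : ℝ => Complex.exp (pair (v j) z * a))]
    congr 1
    refine Finset.prod_congr rfl fun j _ => ?_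
    rw [integral_indicator measurableSet_Ioc, ← intervalIntegral.integral_of_le zero_le_one,
      integral_exp_mul_complex (hz j)]
    simp

theorem integrable_openCone {b v : Fin d → RInf} (hli : LinearIndependent ℝ v)
    {T : (Fin d → ℝ) ≃ₗ[ℝ] (Fin d → ℝ)} (hT : ∀ s, ∑ i, T s i • b i = ∑ j, s j • v j) {z : DualC}
    (hz : ∀ j, (pair (v j) z).re < 0) : ∃ w, IntValue b z ((openCone v).indicator 1) w := by
  have hprod := indicator_mul_expPair_eq_prod hli z (Set.Ioi 0)
  refine ⟨_, ?_, rfl⟩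
  rw [← integrable_comp_linearEquiv_iff T]
  simp only [hT]
  change Integrable (fun s : Fin d → ℝ => {x : RInf | ∃ c : Fin d → ℝ,
    (∀ j, c j ∈ Set.Ioi 0) ∧ x = ∑ j, c j • v j}.indicator (1 : RInf → ℂ) (∑ j, s j • v j) *
      expPair z (∑ j, s j • v j))
  simp only [hprod]
  refine Integrable.fintype_prod fun j => ?_
  rw [integrable_indicator_iff measurableSet_Ioi]
  exact integrableOn_exp_mul_complex_Ioi (hz j) 0

theorem exists_regInt_openCone {Λ : Submodule ℤ RInf} (hΛ : ∀ x ∈ Λ, IsRat x) {b : Fin d → RInf}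
    (hb : IsLatticeBasis Λ b) {r : ℕ} {v : Fin r → RInf} (hli : LinearIndependent ℝ v)
    (hv : ∀ j, v j ∈ Λ) : ∃ G : DualC → ℂ,
      (∀ᶠ z in poleFilter, RegValue (IntValue b z) (Submodule.span ℝ (Set.range b)) (expPair z)
        ((openCone v).indicator 1) (G z)) ∧
      ∀ (m : ℕ) (L : Fin m → RInf), (∀ x ∈ Λ, IsRatComb L x) → IsRatMero L G := by
  have hvb : ∀ j, v j ∈ Submodule.span ℝ (Set.range b) := fun j =>
    Submodule.span_subset_span ℤ ℝ _ (hb.2.symm ▸ hv j)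
  by_cases hi : ∃ i, b i ∉ Submodule.span ℝ (Set.range v)
  · obtain ⟨i, hi⟩ := hi
    refine ⟨0, Eventually.of_forall fun z => RegValue.of_value (intValue_zero_of_subset hi ?_ z),
      fun m L _ => IsRatMero.zero⟩
    exact openCone_subset_closedCone.trans closedCone_subset_span
  · push Not at hi
    have hspan : Submodule.span ℝ (Set.range v) = Submodule.span ℝ (Set.range b) :=
      le_antisymm (Submodule.span_le.2 (Set.range_subset_iff.2 hvb))
        (Submodule.span_le.2 (Set.range_subset_iff.2 hi))
    obtain rfl : r = d := by
      have h1 := finrank_span_eq_card hli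
      have h2 := finrank_span_eq_card hb.1
      rw [hspan, h2] at h1
      simpa using h1.symm
    obtain ⟨T, hT, q, hq⟩ := exists_coordChange hb hli hv
    have hv0 := hli.ne_zero
    -- The box integral is `|q| ∏ (e^{w_j} - 1) / w_j` with `w_j = pair (v j) z`; dividing by `∏ (1
    -- - e^{w_j})` leaves `|q| (-1)^r / ∏ w_j`.
    refine ⟨fun z => (((|q| : ℤ) * (-1) ^ r : ℚ) : ℂ) / ∏ j, pair (v j) z, ?_,
      fun m L hL => isRatMero_prod_inv (fun j => hL _ (hv j)) hv0 _⟩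
    have hne : ∀ᶠ z in poleFilter, ∀ j, pair (v j) z ≠ 0 ∧ Complex.exp (pair (v j) z) ≠ 1 :=
      eventually_all.2 fun j => (eventually_pair_ne_zero (hΛ _ (hv j)) (hv0 j)).and
        (eventually_exp_pair_ne_one (hΛ _ (hv j)) (hv0 j))
    filter_upwards [hne] with z hz
    refine ⟨List.ofFn v, fun u hu => ?_, ?_⟩
    · obtain ⟨j, rfl⟩ := (List.mem_ofFn' _ _).1 hu
      exact ⟨hvb j, (hz j).2⟩
    · have hbox := diffOps_indicator_openCone hli (Λ := ⊤) fun _ => AddSubgroup.mem_top _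
      rw [AddSubgroup.coe_top, Set.inter_univ, Set.inter_univ] at hbox
      rw [hbox, prod_map_ofFn]
      convert intValue_halfOpenBox hli hT (fun j => (hz j).1) using 1
      rw [hq, Finset.prod_div_distrib, mul_div_assoc', mul_div_assoc']
      congr 1
      have : ∏ j, (Complex.exp (pair (v j) z) - 1) = (-1) ^ r * ∏ j, (1 - expPair z (v j)) := by
        rw [← Fin.prod_const, ← Finset.prod_mul_distrib]
        exact Finset.prod_congr rfl fun j _ => by rw [expPair]; ring
      rw [this, ← Int.cast_abs, Complex.ofReal_intCast]
      simp only [Rat.cast_mul, Rat.cast_intCast, Rat.cast_pow, Rat.cast_neg, Rat.cast_one]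
      ring

end Integral

namespace LatticeCone

variable (C : LatticeCone)

/-- `G` represents the regularized exponential integral of the lattice cone. -/
def IsRegInt {d : ℕ} (b : Fin d → RInf) (G : DualC → ℂ) : Prop :=
  ∀ᶠ z in poleFilter, RegValue (IntValue b z) (Submodule.span ℝ (Set.range b)) (expPair z)
    (C.interior.indicator 1) (G z)

theorem exists_isRegInt {d : ℕ} {b : Fin d → RInf} (hb : IsLatticeBasis C.lattice b) :
    ∃ G : DualC → ℂ, C.IsRegInt b G ∧
      ∀ (m : ℕ) (L : Fin m → RInf), (∀ i, IsRat (L i)) → (∀ x ∈ C.lattice, IsRatComb L x) →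
        IsRatMero L G := by
  obtain ⟨κ, _, r, v, hli, hv, hcov, hdisj⟩ := C.exists_simplicial_decomposition
  choose G hG hGL using fun k => exists_regInt_openCone C.lattice_rat hb (hli k) (hv k)
  refine ⟨∑ k, G k, ?_, fun m L hL hC => IsRatMero.sum hL _ fun k _ => hGL k m L hC⟩
  filter_upwards [eventually_all.2 hG] with z hz
  have hind : C.interior.indicator 1 = ∑ k, (openCone (v k)).indicator (1 : RInf → ℂ) := by
    have h1 : C.interior = ⋃ k ∈ Finset.univ, openCone (v k) := by simp [hcov]
    rw [h1, Finset.indicator_biUnion]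
    · ext x
      simp
    · exact fun k _ k' _ h => hdisj h
  rw [hind, Finset.sum_apply]
  exact RegValue.sum (isEquivariant_intValue b z) _ fun k _ => hz k

/-- In the coordinates of a lattice basis, a lattice cone differs from its interior by a null set. -/
theorem ae_mem_cone_iff {d : ℕ} {b : Fin d → RInf} (hb : IsLatticeBasis C.lattice b) :
    ∃ S : Set (Fin d → ℝ), MeasurableSet S ∧
      {t : Fin d → ℝ | ∑ i, t i • b i ∈ C.cone} =ᵐ[volume] S ∧
      {t : Fin d → ℝ | ∑ i, t i • b i ∈ C.interior} =ᵐ[volume] S := by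
  set X : Set (Fin d → ℝ) := {t | ∑ i, t i • b i ∈ C.cone} with hX
  have hconv : Convex ℝ X := by
    have := C.convex_cone.linear_preimage (Fintype.linearCombination ℝ b)
    simpa [Set.preimage, Fintype.linearCombination_apply] using this
  have hint : _root_.interior X ⊆ {t | ∑ i, t i • b i ∈ C.interior} := by
    intro t ht
    have htX : t ∈ X := _root_.interior_subset ht
    refine ⟨htX, fun y hy => ?_⟩
    have hyb : y ∈ Submodule.span ℝ (Set.range b) :=
      C.span_basis hb ▸ Submodule.subset_span hy
    obtain ⟨s, rfl⟩ := (Submodule.mem_span_range_iff_exists_fun ℝ).1 hyb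
    have hc : Continuous fun ε : ℝ => t - ε • s := by fun_prop
    have hev : ∀ᶠ ε : ℝ in 𝓝 0, t - ε • s ∈ _root_.interior X :=
      hc.continuousAt.eventually (by simpa using isOpen_interior.mem_nhds ht)
    obtain ⟨ε, h1, hε⟩ :=
      ((hev.filter_mono nhdsWithin_le_nhds).and (self_mem_nhdsWithin (s := Set.Ioi (0 : ℝ)))).exists
    refine ⟨ε, hε, ?_⟩
    have hX' : t - ε • s ∈ X := _root_.interior_subset h1
    have h2 : ∑ i, (t - ε • s) i • b i ∈ C.cone := hX'
    simpa [sub_smul, Finset.smul_sum, smul_smul] using h2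
  have hle : {t : Fin d → ℝ | ∑ i, t i • b i ∈ C.interior} ⊆ X := fun t ht => ht.1
  -- The frontier of a convex set is null. The interior of C, in coordinates, lies between the
  -- topological interior of X and X itself.
  have hnull : volume (X \ _root_.interior X) = 0 :=
    measure_mono_null (Set.sdiff_subset_sdiff_left subset_closure) (hconv.addHaar_frontier volume)
  refine ⟨_root_.interior X, isOpen_interior.measurableSet, ?_, ?_⟩
  · exact (ae_le_set.2 hnull).antisymm _root_.interior_subset.eventuallyLE
  · refine (ae_le_set.2 (measure_mono_null (Set.sdiff_subset_sdiff_left hle) hnull)).antisymm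
      hint.eventuallyLE

theorem intValue_iff {d : ℕ} {b : Fin d → RInf} (hb : IsLatticeBasis C.lattice b) {z : DualC} {w : ℂ} :
    IntValue b z (C.interior.indicator 1) w ↔
      IntegrableOn (fun t : Fin d → ℝ => Complex.exp (pair (∑ i, t i • b i) z))
          {t | ∑ i, t i • b i ∈ C.cone} ∧
        ∫ t in {t : Fin d → ℝ | ∑ i, t i • b i ∈ C.cone},
          Complex.exp (pair (∑ i, t i • b i) z) = w := by
  obtain ⟨S, hS, h1, h2⟩ := C.ae_mem_cone_iff hb
  have hf : (fun t : Fin d → ℝ => C.interior.indicator (1 : RInf → ℂ) (∑ i, t i • b i) *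
      expPair z (∑ i, t i • b i)) =ᵐ[volume]
        S.indicator fun t : Fin d → ℝ => Complex.exp (pair (∑ i, t i • b i) z) := by
    filter_upwards [h2] with t ht
    have ht : (∑ i, t i • b i ∈ C.interior) = (t ∈ S) := ht
    by_cases h : t ∈ S
    · rw [Set.indicator_of_mem h, Set.indicator_of_mem (ht.mpr h), Pi.one_apply, one_mul, expPair]
    · rw [Set.indicator_of_notMem h, Set.indicator_of_notMem (fun h' => h (ht.mp h')), zero_mul]
  rw [IntValue, integrable_congr hf, integral_congr_ae hf, integrable_indicator_iff hS,
    integral_indicator hS, integrableOn_congr_set_ae h1, setIntegral_congr_set h1]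

end LatticeCone

/-! ### Convergence on the dual cone -/

theorem summable_pi_geometric {r : ℕ} {x : Fin r → ℝ} (h0 : ∀ j, 0 ≤ x j) (h1 : ∀ j, x j < 1) :
    Summable fun k : Fin r → ℕ => ∏ j, x j ^ k j := by
  induction r with
  | zero => exact (hasSum_fintype _).summable
  | succ r ih =>
    rw [← (Fin.consEquiv fun _ => ℕ).summable_iff]
    have h := (summable_geometric_of_lt_one (h0 0) (h1 0)).mul_of_nonneg
      (ih (fun j => h0 j.succ) fun j => h1 j.succ) (fun k => pow_nonneg (h0 0) k)
      (fun k => Finset.prod_nonneg fun j _ => pow_nonneg (h0 _) _)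
    refine h.congr fun k => ?_
    simp [Fin.prod_univ_succ, Fin.consEquiv]

theorem exists_box_decomposition {r : ℕ} {v : Fin r → RInf} {x : RInf} (hx : x ∈ openCone v) :
    ∃ n ∈ halfOpenBox v, ∃ k : Fin r → ℕ, x = n + ∑ j, (k j : ℝ) • v j := by
  obtain ⟨c, hc, rfl⟩ := hx
  have hceil : ∀ j, 0 < ⌈c j⌉₊ := fun j => Nat.ceil_pos.2 (hc j)
  have hcast : ∀ j, ((⌈c j⌉₊ - 1 : ℕ) : ℝ) = (⌈c j⌉₊ : ℝ) - 1 := fun j => by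
    rw [Nat.cast_sub (hceil j), Nat.cast_one]
  -- The ceiling minus one, and not the floor, because the box contains the coordinate 1 but not 0.
  refine ⟨∑ j, (c j - (⌈c j⌉₊ - 1 : ℕ)) • v j, ⟨_, fun j => ⟨?_, ?_⟩, rfl⟩,
    fun j => ⌈c j⌉₊ - 1, ?_⟩
  · have := Nat.ceil_lt_add_one (hc j).le
    rw [hcast]
    linarith
  · have := Nat.le_ceil (c j)
    rw [hcast]
    linarith
  · rw [← Finset.sum_add_distrib]
    exact Finset.sum_congr rfl fun j _ => by rw [← add_smul, sub_add_cancel]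

/-- Splitting off the box part embeds the lattice points of the open cone into a finite set times
`ℕ^r`, where the terms form a product of a finite sum and convergent geometric series. -/
theorem exists_sumValue_openCone {Λ : Submodule ℤ RInf} {d : ℕ} {b : Fin d → RInf}
    (hb : IsLatticeBasis Λ b) {r : ℕ} {v : Fin r → RInf} (hv : ∀ j, v j ∈ Λ) {z : DualC}
    (hz : ∀ j, (pair (v j) z).re < 0) : ∃ w, SumValue z ((openCone v ∩ Λ).indicator 1) w := by
  set B : Set RInf := halfOpenBox v ∩ (Λ.toAddSubgroup : Set RInf)
  have : Finite B := (finite_halfOpenBox_inter hb hv).to_subtype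
  have hdec : ∀ x : (openCone v ∩ Λ : Set RInf), ∃ nk : B × (Fin r → ℕ),
      x.1 = nk.1.1 + ∑ j, (nk.2 j : ℝ) • v j := by
    rintro ⟨x, hx, hxΛ⟩
    obtain ⟨n, hn, k, hk⟩ := exists_box_decomposition hx
    have hsum : ∑ j, (k j : ℝ) • v j ∈ Λ := Λ.sum_mem fun j _ => by
      rw [Nat.cast_smul_eq_nsmul]
      exact Λ.toAddSubmonoid.nsmul_mem (hv j) _
    refine ⟨⟨⟨n, hn, ?_⟩, k⟩, hk⟩
    have : n = x - ∑ j, (k j : ℝ) • v j := by rw [hk, add_sub_cancel_right]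
    rw [this]
    exact Λ.sub_mem hxΛ hsum
  choose φ hφ using hdec
  have hinj : Function.Injective φ := fun x y h => Subtype.ext (by rw [hφ x, hφ y, h])
  have hnorm : ∀ k : Fin r → ℕ, ‖∏ j, expPair z (v j) ^ k j‖ = ∏ j, ‖expPair z (v j)‖ ^ k j := by
    intro k
    simp [norm_prod, norm_pow]
  have hlt : ∀ j, ‖expPair z (v j)‖ < 1 := fun j => by
    rw [expPair, Complex.norm_exp, Real.exp_lt_one_iff]
    exact hz j
  have hg := summable_mul_of_summable_norm (f := fun n : B => expPair z n.1)
    (g := fun k : Fin r → ℕ => ∏ j, expPair z (v j) ^ k j) Summable.of_finite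
    (by simpa only [hnorm] using summable_pi_geometric (fun j => norm_nonneg _) hlt)
  have hX : Summable fun x : (openCone v ∩ Λ : Set RInf) => expPair z x.1 := by
    refine (hg.comp_injective hinj).congr fun x => ?_
    rw [hφ x, expPair_add, Function.comp]
    congr 1
    rw [expPair, pair_sum_smul, Complex.exp_sum]
    refine Finset.prod_congr rfl fun j _ => ?_
    rw [expPair, ← Complex.exp_nat_mul]
    simp
  have hX' : Summable ((openCone v ∩ Λ : Set RInf).indicator (expPair z)) :=
    summable_subtype_iff_indicator.1 hX
  refine ⟨_, (hX'.congr fun x => ?_).hasSum⟩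
  by_cases hx : x ∈ openCone v ∩ Λ
  · simp [hx]
  · rw [Set.indicator_of_notMem hx, Set.indicator_of_notMem hx, zero_mul]

/-- Two bases of one lattice are related by mutually inverse integer matrices, so the determinant is
±1 and the measure is the same. -/
theorem intValue_of_basis {Λ : Submodule ℤ RInf} {d : ℕ} {b b' : Fin d → RInf}
    (hb : IsLatticeBasis Λ b) (hb' : IsLatticeBasis Λ b') {z : DualC} {f : RInf → ℂ} {w : ℂ}
    (h : IntValue b z f w) : IntValue b' z f w := by
  have hmem : ∀ {b : Fin d → RInf}, IsLatticeBasis Λ b → ∀ j, b j ∈ Λ :=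
    fun h j => h.2 ▸ Submodule.subset_span ⟨j, rfl⟩
  obtain ⟨T, hT, q, hq⟩ := exists_coordChange hb hb'.1 (hmem hb')
  obtain ⟨T', hT', q', hq'⟩ := exists_coordChange hb' hb.1 (hmem hb)
  have hcomp : (T : (Fin d → ℝ) →ₗ[ℝ] (Fin d → ℝ)) ∘ₗ (T' : (Fin d → ℝ) →ₗ[ℝ] (Fin d → ℝ)) =
      LinearMap.id := by
    refine LinearMap.ext fun s => ?_
    have h0 : ∑ i, (T (T' s) - s) i • b i = 0 := by
      simp [sub_smul, hT, hT']
    funext i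
    exact sub_eq_zero.1 (Fintype.linearIndependent_iff.1 hb.1 _ h0 i)
  have hdet : q * q' = 1 := by
    have := congrArg LinearMap.det hcomp
    rw [LinearMap.det_comp, hq, hq', LinearMap.det_id] at this
    exact_mod_cast this
  have habs : |(q : ℝ)| = 1 := by
    have := Int.isUnit_iff_abs_eq.1 (IsUnit.of_mul_eq_one _ hdet)
    exact_mod_cast this
  have h1 := integrable_comp_linearEquiv_iff T
    fun t : Fin d → ℝ => f (∑ i, t i • b i) * expPair z (∑ i, t i • b i)
  have h2 := integral_comp_linearEquiv T
    fun t : Fin d → ℝ => f (∑ i, t i • b i) * expPair z (∑ i, t i • b i)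
  simp only [hT] at h1 h2
  rw [hq, habs, Complex.ofReal_one, one_mul] at h2
  exact ⟨h1.2 h.1, h2 ▸ h.2⟩

theorem isRatComb_basis {Λ : Submodule ℤ RInf} {d : ℕ} {b : Fin d → RInf} (hb : IsLatticeBasis Λ b)
    {x : RInf} (hx : x ∈ Λ) : IsRatComb b x := by
  rw [← hb.2] at hx
  obtain ⟨c, rfl⟩ := (Submodule.mem_span_range_iff_exists_fun ℤ).1 hx
  exact ⟨fun i => c i, Finset.sum_congr rfl fun i _ => by simp [Int.cast_smul_eq_zsmul]⟩

namespace LatticeCone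

/-! ### Regularized values and subdivisions -/

variable {C D : LatticeCone} {P : Finset LatticeCone}

/-- The induced lattices make the lattice points in the interiors of the pieces a partition of those
in the interior of C, so additivity of regularized values applies. -/
theorem IsRegSum.of_subdivision (hP : C.IsSubdivision P) {G : LatticeCone → DualC → ℂ}
    (hG : ∀ D ∈ P, D.IsRegSum (G D)) : C.IsRegSum (∑ D ∈ P, G D) := by
  filter_upwards [(Finset.eventually_all P).2 hG] with z hz
  have hind : C.latticeIndicator = ∑ D ∈ P, D.latticeIndicator := by
    have h1 : C.interior ∩ C.lattice = ⋃ D ∈ P, D.interior ∩ (D.lattice : Set RInf) := by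
      rw [hP.cover]
      ext x
      simp only [Set.mem_inter_iff, Set.mem_iUnion, exists_prop, SetLike.mem_coe]
      constructor
      · rintro ⟨⟨D, hD, hx⟩, hxC⟩
        exact ⟨D, hD, hx, (hP.lattice_eq D hD x).2 ⟨hxC, Submodule.subset_span hx.1⟩⟩
      · rintro ⟨D, hD, hx, hxD⟩
        exact ⟨⟨D, hD, hx⟩, ((hP.lattice_eq D hD x).1 hxD).1⟩
    rw [latticeIndicator, h1, Finset.indicator_biUnion]
    · ext x
      simp [latticeIndicator]
    · exact fun D hD D' hD' h =>
        (hP.disjoint hD hD' h).mono Set.inter_subset_left Set.inter_subset_left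
  rw [hind, Finset.sum_apply]
  exact RegValue.sum (isEquivariant_sumValue z) _ hz

theorem IsRegSum.unique {G G' : DualC → ℂ} (h : C.IsRegSum G) (h' : C.IsRegSum G') :
    G =ᶠ[poleFilter] G' := by
  filter_upwards [h, h'] with z hz hz'
  exact hz.unique (isEquivariant_sumValue z) hz'

open Classical in
theorem IsRegInt.of_subdivision (hP : C.IsSubdivision P) {d : ℕ} {b : Fin d → RInf}
    (hb : IsLatticeBasis C.lattice b) {G : LatticeCone → DualC → ℂ}
    (hG : ∀ D ∈ P, D.lattice = C.lattice → D.IsRegInt b (G D)) :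
    C.IsRegInt b (∑ D ∈ P with D.lattice = C.lattice, G D) := by
  have hG' : ∀ D ∈ P, ∀ᶠ z in poleFilter, D.lattice = C.lattice → RegValue (IntValue b z)
      (Submodule.span ℝ (Set.range b)) (expPair z) (D.interior.indicator 1) (G D z) := by
    intro D hD
    by_cases h : D.lattice = C.lattice
    · filter_upwards [hG D hD h] with z hz _ using hz
    · simp [h]
  filter_upwards [(Finset.eventually_all P).2 hG'] with z hz
  have hind : C.interior.indicator 1 = ∑ D ∈ P, D.interior.indicator (1 : RInf → ℂ) := by
    rw [hP.cover, Finset.indicator_biUnion _ _ hP.disjoint]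
    ext x
    simp
  rw [hind, Finset.sum_apply, Finset.sum_filter]
  refine RegValue.sum (isEquivariant_intValue b z) _ fun D hD => ?_
  split_ifs with h
  · exact hz D hD h
  -- A piece whose span contained the whole basis would carry the lattice of C; any other piece is
  -- null.
  · obtain ⟨i, hi⟩ : ∃ i, b i ∉ Submodule.span ℝ D.cone := by
      by_contra! hall
      refine h (le_antisymm (fun x hx => ((hP.lattice_eq D hD x).1 hx).1) ?_)
      rw [← hb.2]
      refine Submodule.span_le.2 (Set.range_subset_iff.2 fun i => ?_)
      exact (hP.lattice_eq D hD _).2 ⟨hb.2 ▸ Submodule.subset_span ⟨i, rfl⟩, hall i⟩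
    exact RegValue.of_value
      (intValue_zero_of_subset hi (interior_subset.trans Submodule.subset_span) z)

theorem IsRegInt.unique {d : ℕ} {b : Fin d → RInf} {G G' : DualC → ℂ} (h : C.IsRegInt b G)
    (h' : C.IsRegInt b G') : G =ᶠ[poleFilter] G' := by
  filter_upwards [h, h'] with z hz hz'
  exact hz.unique (isEquivariant_intValue b z) hz'

/-! ### Comparison with the convergent sums and integrals. -/

theorem sumValue_latticeIndicator_iff {z : DualC} {w : ℂ} :
    SumValue z C.latticeIndicator w ↔ HasSum
      (fun n : {n : RInf // n ∈ C.interior ∧ n ∈ C.lattice} => Complex.exp (pair n.1 z)) w := by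
  have h := hasSum_subtype_iff_indicator (f := fun x => Complex.exp (pair x z)) (a := w)
    (s := C.interior ∩ C.lattice)
  refine Iff.trans ?_ h.symm
  have : (fun x => C.latticeIndicator x * expPair z x) =
      (C.interior ∩ C.lattice).indicator fun x => Complex.exp (pair x z) := by
    ext x
    by_cases hx : x ∈ C.interior ∩ C.lattice
    · rw [latticeIndicator, Set.indicator_of_mem hx, Set.indicator_of_mem hx, Pi.one_apply, one_mul,
        expPair]
    · rw [latticeIndicator, Set.indicator_of_notMem hx, Set.indicator_of_notMem hx, zero_mul]
  rw [SumValue, this]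

/-- A convergent sum is a regularized value with no difference operators, so the two germs agree on
the dual cone, and hence everywhere. -/
theorem IsRegSum.eq_of_isConvergentExpSum (hC : C.StronglyConvex) {G : DualC → ℂ} (hG : C.IsRegSum G)
    (hGM : (G : PoleGerm) ∈ MQ) {f : PoleGerm} (hf : IsConvergentExpSum C f) :
    f = (G : PoleGerm) := by
  obtain ⟨hfM, F, hF, h⟩ := hf
  refine eq_of_eventually_negDual hC hfM hGM hF rfl ?_
  filter_upwards [h, hG.filter_mono inf_le_left] with z h1 h2
  exact (RegValue.of_value (sumValue_latticeIndicator_iff.2 h1)).unique (isEquivariant_sumValue z) h2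

theorem IsRegInt.eq_of_isConvergentExpInt (hC : C.StronglyConvex) {d : ℕ} {b : Fin d → RInf}
    (hb : IsLatticeBasis C.lattice b) {G : DualC → ℂ} (hG : C.IsRegInt b G)
    (hGM : (G : PoleGerm) ∈ MQ) {f : PoleGerm} (hf : IsConvergentExpInt C f) :
    f = (G : PoleGerm) := by
  obtain ⟨hfM, F, hF, d', b', hb', h⟩ := hf
  obtain rfl : d' = d := by
    have h1 := finrank_span_eq_card hb.1
    have h2 := finrank_span_eq_card hb'.1
    rw [C.span_basis hb, ← C.span_basis hb', h2] at h1
    simpa using h1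
  refine eq_of_eventually_negDual hC hfM hGM hF rfl ?_
  filter_upwards [h, hG.filter_mono inf_le_left] with z h1 h2
  exact (RegValue.of_value (intValue_of_basis hb' hb ((C.intValue_iff hb').2 h1))).unique
    (isEquivariant_intValue b z) h2

theorem mem_lattice_simplicial {r : ℕ} {v : Fin r → RInf} (hv : ∀ j, v j ∈ C.lattice) (j : Fin r) :
    v j ∈ (C.simplicial v hv).lattice :=
  Submodule.mem_inf.2 ⟨hv j, Submodule.subset_span (mem_closedCone j)⟩

theorem re_pair_neg_of_mem_negDual {r : ℕ} {v : Fin r → RInf} (hli : LinearIndependent ℝ v)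
    (hv : ∀ j, v j ∈ C.lattice) {z : DualC} (hz : z ∈ (C.simplicial v hv).negDual) (j : Fin r) :
    (pair (v j) z).re < 0 :=
  hz.2 _ (mem_closedCone j) (hli.ne_zero j)

/-- On the dual cone the geometric series along the generators converge, and uniqueness of
regularized values identifies their sum. -/
theorem IsRegSum.isConvergentExpSum_simplicial {r : ℕ} {v : Fin r → RInf}
    (hli : LinearIndependent ℝ v) (hv : ∀ j, v j ∈ C.lattice) {G : DualC → ℂ}
    (hG : (C.simplicial v hv).IsRegSum G) (hGM : (G : PoleGerm) ∈ MQ) :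
    IsConvergentExpSum (C.simplicial v hv) (G : PoleGerm) := by
  refine ⟨hGM, G, rfl, ?_⟩
  obtain ⟨d, b, hb, -⟩ := (C.simplicial v hv).isLattice
  filter_upwards [hG.filter_mono inf_le_left, mem_inf_of_right (mem_principal_self _)] with z h1 h2
  obtain ⟨w, hw⟩ := exists_sumValue_openCone hb (mem_lattice_simplicial hv)
    (re_pair_neg_of_mem_negDual hli hv h2)
  rw [← simplicial_interior hli hv] at hw
  rw [← sumValue_latticeIndicator_iff,
    h1.unique (isEquivariant_sumValue z) (RegValue.of_value hw)]
  exact hw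

theorem IsRegInt.isConvergentExpInt_simplicial {r : ℕ} {v : Fin r → RInf}
    (hli : LinearIndependent ℝ v) (hv : ∀ j, v j ∈ C.lattice) {d : ℕ} {b : Fin d → RInf}
    (hb : IsLatticeBasis (C.simplicial v hv).lattice b) {G : DualC → ℂ}
    (hG : (C.simplicial v hv).IsRegInt b G) (hGM : (G : PoleGerm) ∈ MQ) :
    IsConvergentExpInt (C.simplicial v hv) (G : PoleGerm) := by
  refine ⟨hGM, G, rfl, d, b, hb, ?_⟩
  obtain rfl : r = d := by
    have h1 := finrank_span_eq_card hb.1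
    have h2 := finrank_span_eq_card hli
    rw [span_basis _ hb, show (C.simplicial v hv).cone = closedCone v from rfl, span_closedCone,
      h2] at h1
    simpa using h1
  obtain ⟨T, hT, -⟩ := exists_coordChange hb hli (mem_lattice_simplicial hv)
  filter_upwards [hG.filter_mono inf_le_left, mem_inf_of_right (mem_principal_self _)] with z h1 h2
  obtain ⟨w, hw⟩ := integrable_openCone hli hT (re_pair_neg_of_mem_negDual hli hv h2)
  rw [← simplicial_interior hli hv] at hw
  rw [← intValue_iff _ hb, h1.unique (isEquivariant_intValue b z) (RegValue.of_value hw)]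
  exact hw

end LatticeCone

/-! ### Well-definedness and locality. -/

theorem coe_sum_germ {κ : Type*} (s : Finset κ) (G : κ → DualC → ℂ) :
    ((∑ k ∈ s, G k : DualC → ℂ) : PoleGerm) = ∑ k ∈ s, (G k : PoleGerm) :=
  map_sum (Germ.coeAddHom poleFilter) G s

theorem LatticeCone.coe_mem_MQ {C : LatticeCone} {G : DualC → ℂ} (hG : ∀ (m : ℕ) (L : Fin m → RInf),
    (∀ i, IsRat (L i)) → (∀ x ∈ C.lattice, IsRatComb L x) → IsRatMero L G) :
    (G : PoleGerm) ∈ MQ := by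
  obtain ⟨k, hk⟩ := C.exists_isRatComb_unitVec
  exact ⟨k, (hG k _ (fun i => isRat_unitVec i) hk).isMeroIn⟩

/-- Bases of the two lattices serve as the two families of linear forms. -/
theorem LatticeCone.Orth.germOrth {Q : LinearMap.BilinForm ℝ RInf} {C D : LatticeCone}
    (h : LatticeCone.Orth Q C D) {G H : DualC → ℂ}
    (hG : ∀ (m : ℕ) (L : Fin m → RInf), (∀ i, IsRat (L i)) →
      (∀ x ∈ C.lattice, IsRatComb L x) → IsRatMero L G)
    (hH : ∀ (m : ℕ) (L : Fin m → RInf), (∀ i, IsRat (L i)) →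
      (∀ x ∈ D.lattice, IsRatComb L x) → IsRatMero L H) :
    GermOrth Q (G : PoleGerm) (H : PoleGerm) := by
  obtain ⟨m, b, hb, -⟩ := C.isLattice
  obtain ⟨n, b', hb', -⟩ := D.isLattice
  have hbC : ∀ i, b i ∈ C.lattice := fun i => hb.2 ▸ Submodule.subset_span ⟨i, rfl⟩
  have hbD : ∀ i, b' i ∈ D.lattice := fun i => hb'.2 ▸ Submodule.subset_span ⟨i, rfl⟩
  have hC : ∀ i, IsRat (b i) := fun i => C.lattice_rat _ (hbC i)
  have hD : ∀ i, IsRat (b' i) := fun i => D.lattice_rat _ (hbD i)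
  exact ⟨_, _, b, b', hC, hD, fun i j => h _ (hbC i) _ (hbD j),
    (hG _ _ hC fun x hx => isRatComb_basis hb hx).isMeroIn,
    (hH _ _ hD fun x hx => isRatComb_basis hb' hx).isMeroIn⟩

open LatticeCone in
/-- The extension of the exponential sum by subdivisions is well defined, and it preserves
orthogonality for every bilinear form. -/
theorem exists_expSum : ∃ S : LatticeCone → MQ, (∀ C f, IsExpSum C f ↔ f = (S C : PoleGerm)) ∧
    ∀ (Q : LinearMap.BilinForm ℝ RInf) (C D : LatticeCone), Orth Q C D →
      GermOrth Q (S C : PoleGerm) (S D : PoleGerm) := by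
  choose G hG hGL using fun C : LatticeCone => C.exists_isRegSum
  refine ⟨fun C => ⟨G C, coe_mem_MQ (hGL C)⟩, fun C f => ⟨?_, ?_⟩,
    fun Q C D h => h.germOrth (hGL C) (hGL D)⟩
  · rintro ⟨P, g, hP, hg, rfl⟩
    rw [Finset.sum_congr rfl fun D hD => (hG D).eq_of_isConvergentExpSum (hP.stronglyConvex D hD)
      (coe_mem_MQ (hGL D)) (hg D hD), ← coe_sum_germ]
    exact Germ.coe_eq.2 ((IsRegSum.of_subdivision hP fun D _ => hG D).unique (hG C))
  · rintro rfl
    obtain ⟨P, hP, hsimp⟩ := C.exists_simplicial_subdivision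
    refine ⟨P, fun D => G D, hP, fun D hD => ?_, ?_⟩
    · obtain ⟨r, v, hv, hli, rfl⟩ := hsimp D hD
      exact (hG _).isConvergentExpSum_simplicial hli hv (coe_mem_MQ (hGL _))
    · rw [← coe_sum_germ]
      exact Germ.coe_eq.2 ((hG C).unique (IsRegSum.of_subdivision hP fun D _ => hG D))

open LatticeCone in
/-- The extension of the exponential integral by subdivisions is well defined, and it preserves
orthogonality for every bilinear form. -/
theorem exists_expInt : ∃ I : LatticeCone → MQ, (∀ C f, IsExpInt C f ↔ f = (I C : PoleGerm)) ∧
    ∀ (Q : LinearMap.BilinForm ℝ RInf) (C D : LatticeCone), Orth Q C D →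
      GermOrth Q (I C : PoleGerm) (I D : PoleGerm) := by
  classical
  choose d b hb _ using fun C : LatticeCone => C.isLattice
  choose G₀ hG₀ hGL₀ using fun C : LatticeCone => C.exists_isRegInt (hb C)
  -- The full-dimensional pieces of C are integrated in the basis chosen for C, so their regularized
  -- values can be added; hence G depends on both cones. Its values for pieces with another lattice
  -- are arbitrary and never enter the sum.
  have hbasis : ∀ C D : LatticeCone, D.lattice = C.lattice →
      ∃ G : DualC → ℂ, D.IsRegInt (b C) G ∧ (G : PoleGerm) ∈ MQ := by
    intro C D hD
    obtain ⟨G, hG, hGL⟩ := D.exists_isRegInt (hD ▸ hb C)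
    exact ⟨G, hG, coe_mem_MQ hGL⟩
  choose! G hG hGM using hbasis
  refine ⟨fun C => ⟨G₀ C, coe_mem_MQ (hGL₀ C)⟩, fun C f => ⟨?_, ?_⟩,
    fun Q C D h => h.germOrth (hGL₀ C) (hGL₀ D)⟩
  · rintro ⟨P, g, hP, hg, rfl⟩
    rw [Finset.sum_congr rfl fun D hD => by
      obtain ⟨hDP, hDC⟩ := Finset.mem_filter.1 hD
      exact (hG C D hDC).eq_of_isConvergentExpInt (hP.stronglyConvex D hDP) (hDC ▸ hb C)
        (hGM C D hDC) (hg D hDP hDC), ← coe_sum_germ]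
    exact Germ.coe_eq.2
      ((IsRegInt.of_subdivision hP (hb C) fun D _ hD => hG C D hD).unique (hG₀ C))
  · rintro rfl
    obtain ⟨P, hP, hsimp⟩ := C.exists_simplicial_subdivision
    refine ⟨P, fun D => G C D, hP, fun D hD hDC => ?_, ?_⟩
    · obtain ⟨r, v, hv, hli, rfl⟩ := hsimp D hD
      exact (hG C _ hDC).isConvergentExpInt_simplicial hli hv (hDC ▸ hb C) (hGM C _ hDC)
    · rw [← coe_sum_germ]
      exact Germ.coe_eq.2
        ((hG₀ C).unique (IsRegInt.of_subdivision hP (hb C) fun D _ hD => hG C D hD))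

end ConeLocality

end

theorem proposition2p9
    (Q : LinearMap.BilinForm ℝ ConeLocality.RInf)
    (hsymm : ∀ x y, Q x y = Q y x)
    (hpos : ∀ x, x ≠ 0 → 0 < Q x x)
    (hrat : ∀ i j, ∃ q : ℚ, Q (ConeLocality.unitVec i) (ConeLocality.unitVec j) = (q : ℝ)) :
    ∃ S I : ConeLocality.LatticeCone → ConeLocality.MQ,
      (∀ C f, ConeLocality.IsExpSum C f ↔ f = (S C : ConeLocality.PoleGerm)) ∧
      (∀ C f, ConeLocality.IsExpInt C f ↔ f = (I C : ConeLocality.PoleGerm)) ∧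
      ConeLocality.IsLocalityMap (ConeLocality.LatticeCone.Orth Q)
        (fun f f' : ConeLocality.MQ => ConeLocality.GermOrth Q f f') S ∧
      ConeLocality.IsLocalityMap (ConeLocality.LatticeCone.Orth Q)
        (fun f f' : ConeLocality.MQ => ConeLocality.GermOrth Q f f') I := by
  obtain ⟨S, hS, hSQ⟩ := ConeLocality.exists_expSum
  obtain ⟨I, hI, hIQ⟩ := ConeLocality.exists_expInt
  exact ⟨S, I, hS, hI, hSQ Q, hIQ Q⟩
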